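/- Let $t \ge 1$ and $m = 2t+2$ (so $m \ge 4$ is even), let $1 \le d \le t+1$, put $n = 2^m-1$, and let $\alpha$ be a primitive $n$-th root of unity in $GF(2^m)$. Cyclic codes of length $n$ are ideals of $R_n = GF(2)[x]/(x^n-1)$. For an integer $s$ let $C_s = \{2^k s \bmod n : k \ge 0\}$ be its cyclotomic coset modulo $n$, let $\theta_s \in R_n$ be the primitive idempotent determined by $\theta_s(\alpha^j) = 1$ if $j \bmod n \in C_s$ and $\theta_s(\alpha^j) = 0$ otherwise, and let $\theta_s^* = \theta_{-s}$. Let $\mathcal R(2,m)$ be the second order binary Reed--Muller code, that is, the set of value vectors of Boolean functions of degree at most $2$ in $m$ variables. Identify $\{0,1\}^m$ with $GF(2^m)$ by any $GF(2)$-linear isomorphism, let coordinate $i$ of a cyclic code of length $n$ correspond to the point $\alpha^i$ ($0 \le i < n$), and let the parity check coordinate of the extended code correspond to the point $0$; the punctured code $\mathcal R(2,m)^*$ is obtained from $\mathcal R(2,m)$ by deleting the coordinate at $0$. Then $\theta_0+\theta_1^*+\sum_{j=d}^{t+1}\theta_{1+2^j}^*$ is an idempotent of $R_n$, the cyclic code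 with this idempotent (the ideal it generates) is a subcode of $\mathcal R(2,m)^*$, and extending it by an overall parity check gives a linear subcode of $\mathcal R(2,m)$ with parameters $$[\,2^m,\ m(t-d+2)+m/2+1,\ 2^{m-1}-2^{m-d-1}\,].$$ This extended code contains the all-one word, and the set of weights of its codewords other than the zero word and the all-one word is exactly $$\{2^{m-1}\}\cup\{2^{m-1}-2^{m-h-1},\ 2^{m-1}+2^{m-h-1} : d\le h\le t+1\}.$$ -/

import Mathlib

open Polynomial

/-! ### Linear codes -/

/-- `C` is a binary linear `[n, k, δ]` code: its words have `n` coordinates, its dimension is `k`,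
and its minimum Hamming distance is (exactly) `δ`. -/
def IsLinearCode {ι : Type*} [Fintype ι] (C : Submodule (ZMod 2) (ι → ZMod 2)) (n k δ : ℕ) : Prop :=
  Fintype.card ι = n ∧ Module.finrank (ZMod 2) C = k ∧
    IsLeast {w : ℕ | ∃ x ∈ C, ∃ y ∈ C, x ≠ y ∧ hammingDist x y = w} δ

/-- The Reed-Muller code `R(r, m)`: all (value vectors of) Boolean functions on `{0,1}^m` that are
given by a polynomial of degree at most `r` in `m` variables. -/
noncomputable def reedMuller (r m : ℕ) : Submodule (ZMod 2) ((Fin m → ZMod 2) → ZMod 2) where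
  carrier := {f | ∃ p : MvPolynomial (Fin m) (ZMod 2),
    p.totalDegree ≤ r ∧ ∀ v, f v = MvPolynomial.eval v p}
  zero_mem' := ⟨0, by simp, fun v => by simp⟩
  add_mem' := by
    rintro f g ⟨p, hp, hf⟩ ⟨q, hq, hg⟩
    exact ⟨p + q, (MvPolynomial.totalDegree_add p q).trans (max_le hp hq),
      fun v => by simp [hf v, hg v]⟩
  smul_mem' := by
    rintro a f ⟨p, hp, hf⟩
    exact ⟨a • p, (MvPolynomial.totalDegree_smul_le a p).trans hp,
      fun v => by simp [hf v, MvPolynomial.smul_eval]⟩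

/-! ### Cyclic codes -/

/-- The ring `R_n = F[x]/(x^n - 1)` with `F = GF(2)`. -/
abbrev CyclicRing (n : ℕ) : Type :=
  (ZMod 2)[X] ⧸ Ideal.span {(X ^ n - 1 : (ZMod 2)[X])}

/-- The word `c` as the residue class of the polynomial `c(x) = ∑ c_i x^i`. -/
noncomputable def wordClass (n : ℕ) : (Fin n → ZMod 2) →ₗ[ZMod 2] CyclicRing n where
  toFun c := Ideal.Quotient.mk _ (∑ i : Fin n, C (c i) * X ^ (i : ℕ))
  map_add' c c' := by
    rw [← map_add, ← Finset.sum_add_distrib]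
    simp [add_mul]
  map_smul' a c := by
    have h : ∑ i : Fin n, C ((a • c) i) * X ^ (i : ℕ)
        = a • ∑ i : Fin n, C (c i) * (X : (ZMod 2)[X]) ^ (i : ℕ) := by
      simp [Finset.smul_sum, smul_eq_C_mul, mul_assoc]
    rw [h]
    rfl

/-- The cyclic code of length `n` given by an ideal of `R_n`, as a set of words. -/
noncomputable def cyclicCode {n : ℕ} (I : Ideal (CyclicRing n)) :
    Submodule (ZMod 2) (Fin n → ZMod 2) :=
  (I.restrictScalars (ZMod 2)).comap (wordClass n)

/-- `e` is the idempotent of the cyclic code `I`: it is an idempotent and it generates `I`. -/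
def IsIdempotentOf {n : ℕ} (e : CyclicRing n) (I : Ideal (CyclicRing n)) : Prop :=
  IsIdempotentElem e ∧ Ideal.span {e} = I

/-- Extending by an overall parity check. The new coordinate is `none`. -/
def parityExtend (n : ℕ) : (Fin n → ZMod 2) →ₗ[ZMod 2] (Option (Fin n) → ZMod 2) where
  toFun c i := i.elim (∑ k, c k) c
  map_add' c c' := by
    funext i
    cases i <;> simp [Finset.sum_add_distrib]
  map_smul' a c := by
    funext i
    cases i <;> simp [Finset.mul_sum]

/-- The extended code of a code `D` of length `n`. -/
def extendedCode {n : ℕ} (D : Submodule (ZMod 2) (Fin n → ZMod 2)) :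
    Submodule (ZMod 2) (Option (Fin n) → ZMod 2) :=
  D.map (parityExtend n)

/-! ### Cyclotomic cosets and primitive idempotents -/

/-- The cyclotomic coset `C_s = {s, 2s, 2²s, …}` modulo `n`. -/
def cyclotomicCoset {n : ℕ} (s : ZMod n) : Set (ZMod n) :=
  Set.range fun k : ℕ => (2 : ZMod n) ^ k * s

open Classical in
/-- The property that defines the primitive idempotent `θ_s`, as a polynomial of degree `< n`:
`θ_s(α^j) = 1` if `j ∈ C_s`, and `θ_s(α^j) = 0` otherwise. -/
def IsPrimitiveIdempotent {K : Type*} [Field K] [Algebra (ZMod 2) K] {n : ℕ} (α : K) (s : ZMod n)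
    (p : (ZMod 2)[X]) : Prop :=
  p.degree < n ∧ ∀ j : ℕ, aeval (α ^ j) p = if (j : ZMod n) ∈ cyclotomicCoset s then 1 else 0

section existence

variable {K : Type*} [Field K] [Algebra (ZMod 2) K] {n : ℕ} {α : K}

theorem odd_of_isPrimitiveRoot (hn : 0 < n) (hα : IsPrimitiveRoot α n) : Odd n := by
  have : CharP K 2 := charP_of_injective_algebraMap (algebraMap (ZMod 2) K).injective 2
  by_contra h
  obtain ⟨k, hk⟩ := Nat.not_odd_iff_even.1 h
  have h1 : (α ^ k) ^ 2 = 1 := by rw [← pow_mul, mul_two, ← hk, hα.pow_eq_one]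
  have h2 : α ^ k = 1 := by
    have h3 : (α ^ k - 1) ^ 2 = 0 := by
      rw [sub_pow_char, h1, one_pow, sub_self]
    exact sub_eq_zero.1 (pow_eq_zero_iff (two_ne_zero) |>.1 h3)
  have := Nat.le_of_dvd (by omega) (hα.dvd_of_pow_eq_one k h2)
  omega

theorem two_mul_mem_cyclotomicCoset (ho : Odd n) (s j : ZMod n) :
    2 * j ∈ cyclotomicCoset s ↔ j ∈ cyclotomicCoset s := by
  have hn : 0 < n := ho.pos
  have hN : (2 : ZMod n) ^ n.totient = 1 := by
    have h := congrArg Units.val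
      (ZMod.pow_totient (ZMod.unitOfCoprime 2 (Nat.coprime_two_left.2 ho)))
    rw [Units.val_pow_eq_pow_val, ZMod.coe_unitOfCoprime, Units.val_one] at h
    exact_mod_cast h
  have hpos : 0 < n.totient := Nat.totient_pos.2 hn
  constructor
  · rintro ⟨k, hk⟩
    refine ⟨n.totient - 1 + k, ?_⟩
    have hk' : (2 : ZMod n) ^ k * s = 2 * j := hk
    calc (2 : ZMod n) ^ (n.totient - 1 + k) * s
        = 2 ^ (n.totient - 1) * (2 ^ k * s) := by ring
      _ = 2 ^ (n.totient - 1 + 1) * j := by rw [hk']; ring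
      _ = j := by rw [Nat.sub_add_cancel hpos, hN, one_mul]
  · rintro ⟨k, hk⟩
    exact ⟨k + 1, by simp only at hk ⊢; rw [← hk]; ring⟩

/-- The polynomial `θ_s` exists. -/
theorem exists_isPrimitiveIdempotent (hn : 0 < n) (hα : IsPrimitiveRoot α n) (s : ZMod n) :
    ∃ p, IsPrimitiveIdempotent α s p := by
  classical
  have : CharP K 2 := charP_of_injective_algebraMap (algebraMap (ZMod 2) K).injective 2
  have : NeZero n := ⟨hn.ne'⟩
  have ho := odd_of_isPrimitiveRoot hn hα
  have hα0 : α ≠ 0 := hα.ne_zero hn.ne'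
  have h2u : (2 : ZMod n) = (ZMod.unitOfCoprime 2 (Nat.coprime_two_left.2 ho) : (ZMod n)ˣ) := by
    simp
  let S : Finset (ZMod n) := Finset.univ.filter (· ∈ cyclotomicCoset s)
  let σ : ℕ → K := fun i => ∑ j ∈ S, (α⁻¹ ^ j.val) ^ i
  have hinv : α⁻¹ ^ n = 1 := by rw [inv_pow, hα.pow_eq_one, inv_one]
  have hdouble : ∀ j : ZMod n, α⁻¹ ^ (2 * j).val = (α⁻¹ ^ j.val) ^ 2 := by
    intro j
    rw [two_mul, ZMod.val_add, pow_eq_pow_mod (j.val + j.val) hinv |>.symm, ← pow_mul, mul_two]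
  have hσ : ∀ i, σ i = 0 ∨ σ i = 1 := by
    intro i
    have h1 : σ i ^ 2 = σ i := by
      have e1 : σ i ^ 2 = ∑ j ∈ S, (α⁻¹ ^ (2 * j).val) ^ i := by
        simp only [σ]
        rw [sum_pow_char 2]
        refine Finset.sum_congr rfl fun j _ => ?_
        rw [hdouble]; ring
      rw [e1]
      refine Finset.sum_equiv
        (Units.mulLeft (ZMod.unitOfCoprime 2 (Nat.coprime_two_left.2 ho))) ?_ ?_
      · intro j
        simp only [S, Finset.mem_filter, Finset.mem_univ, true_and, Units.mulLeft_apply, ← h2u]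
        exact (two_mul_mem_cyclotomicCoset ho s j).symm
      · intro j _
        simp only [Units.mulLeft_apply, ← h2u]
    have h2 : σ i * (σ i - 1) = 0 := by linear_combination h1
    rcases mul_eq_zero.1 h2 with h | h
    · exact Or.inl h
    · exact Or.inr (sub_eq_zero.1 h)
  let e : ℕ → ZMod 2 := fun i => if σ i = 1 then 1 else 0
  have he : ∀ i, algebraMap (ZMod 2) K (e i) = σ i := by
    intro i
    rcases hσ i with h | h <;> simp [e, h]
  refine ⟨∑ i ∈ Finset.range n, C (e i) * X ^ i, ?_, ?_⟩
  · refine (degree_sum_le _ _).trans_lt ?_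
    refine (Finset.sup_lt_iff (WithBot.bot_lt_coe n)).2 ?_
    intro i hi
    exact (degree_C_mul_X_pow_le i (e i)).trans_lt (WithBot.coe_lt_coe.2 (Finset.mem_range.1 hi))
  · intro k
    have hgeom : ∀ x : K, x ^ n = 1 → ∑ i ∈ Finset.range n, x ^ i = if x = 1 then 1 else 0 := by
      intro x hx
      split_ifs with h
      · subst h
        obtain ⟨r, hr⟩ := ho
        have : (2 : K) = 0 := CharTwo.two_eq_zero
        simp [hr, this]
      · have h3 := mul_geom_sum x n
        rw [hx, sub_self] at h3
        exact (mul_eq_zero.1 h3).resolve_left (sub_ne_zero.2 h)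
    have key : aeval (α ^ k) (∑ i ∈ Finset.range n, C (e i) * X ^ i)
        = ∑ j ∈ S, if j = (k : ZMod n) then (1 : K) else 0 := by
      simp only [map_sum, map_mul, aeval_C, map_pow, aeval_X, he, σ, Finset.sum_mul]
      rw [Finset.sum_comm]
      refine Finset.sum_congr rfl fun j _ => ?_
      simp only [← mul_pow]
      rw [hgeom]
      · refine if_congr ?_ rfl rfl
        rw [inv_pow, inv_mul_eq_one₀ (pow_ne_zero _ hα0)]
        have h5 : α ^ k = α ^ (k % n) := pow_eq_pow_mod k hα.pow_eq_one
        rw [h5]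
        constructor
        · intro h
          have h6 := hα.pow_inj (ZMod.val_lt j) (Nat.mod_lt _ hn) h
          rw [← ZMod.natCast_zmod_val j, h6, ZMod.natCast_mod]
        · rintro rfl
          rw [ZMod.val_natCast]
      · rw [mul_pow, ← pow_mul, ← pow_mul, mul_comm j.val, mul_comm k, pow_mul, pow_mul, hinv,
          hα.pow_eq_one, one_pow, one_pow, one_mul]
    rw [key, Finset.sum_ite_eq']
    simp [S]

/-- The polynomial `θ_s` is unique. -/
theorem IsPrimitiveIdempotent.unique (hα : IsPrimitiveRoot α n) {s : ZMod n}
    {p q : (ZMod 2)[X]} (hp : IsPrimitiveIdempotent α s p) (hq : IsPrimitiveIdempotent α s q) :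
    p = q := by
  classical
  apply Polynomial.map_injective (algebraMap (ZMod 2) K) (algebraMap (ZMod 2) K).injective
  refine Polynomial.eq_of_degrees_lt_of_eval_index_eq (Finset.range n) (v := fun j => α ^ j)
    ?_ ?_ ?_ ?_
  · intro i hi j hj h
    exact hα.pow_inj (by simpa using hi) (by simpa using hj) h
  · simpa using hp.1
  · simpa using hq.1
  · intro j _
    rw [eval_map_algebraMap, eval_map_algebraMap, hp.2, hq.2]

end existence

open Classical in
/-- The primitive idempotent `θ_s` (with respect to the primitive `n`-th root of unity `α`), as a
polynomial of degree `< n`; the value `0` is never used when `α` is a primitive `n`-th root of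
unity. -/
noncomputable def primitiveIdempotent {K : Type*} [Field K] [Algebra (ZMod 2) K] {n : ℕ} (α : K)
    (s : ZMod n) : (ZMod 2)[X] :=
  if h : ∃ p, IsPrimitiveIdempotent α s p then h.choose else 0

theorem primitiveIdempotent_spec {K : Type*} [Field K] [Algebra (ZMod 2) K] {n : ℕ} {α : K}
    (hn : 0 < n) (hα : IsPrimitiveRoot α n) (s : ZMod n) :
    IsPrimitiveIdempotent α s (primitiveIdempotent α s) := by
  have h := exists_isPrimitiveIdempotent hn hα s
  rw [primitiveIdempotent, dif_pos h]
  exact h.choose_spec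

/-- `θ_s` as an element of `R_n`. -/
noncomputable def theta {K : Type*} [Field K] [Algebra (ZMod 2) K] {n : ℕ} (α : K) (s : ZMod n) :
    CyclicRing n :=
  Ideal.Quotient.mk _ (primitiveIdempotent α s)

/-- `θ_s^* = θ_{-s}`. -/
noncomputable def thetaStar {K : Type*} [Field K] [Algebra (ZMod 2) K] {n : ℕ} (α : K)
    (s : ZMod n) : CyclicRing n :=
  theta α (-s)

/-! ### Cyclic coordinates on the Reed-Muller code -/

section coordinates

variable {K : Type*} [Field K] [Algebra (ZMod 2) K] {m : ℕ}

/-- After `GF(2^m)` is identified with `{0,1}^m` by a linear isomorphism `φ`, the coordinates of an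
extended cyclic code of length `2^m` are placed on `{0,1}^m`: coordinate `i` at `α^i`, and the
parity check coordinate at `0`. -/
def position (φ : K ≃ₗ[ZMod 2] (Fin m → ZMod 2)) (α : K) :
    Option (Fin (2 ^ m - 1)) → (Fin m → ZMod 2)
  | none => φ 0
  | some i => φ (α ^ (i : ℕ))

theorem position_bijective (φ : K ≃ₗ[ZMod 2] (Fin m → ZMod 2)) {α : K}
    (hα : IsPrimitiveRoot α (2 ^ m - 1)) : Function.Bijective (position φ α) := by
  rw [Fintype.bijective_iff_injective_and_card]
  have hpos : 0 < 2 ^ m := by positivity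
  refine ⟨?_, by simp; omega⟩
  have h0 : ∀ i : Fin (2 ^ m - 1), α ^ (i : ℕ) ≠ 0 := fun i =>
    pow_ne_zero _ (hα.ne_zero (by have := i.2; omega))
  rintro (_ | i) (_ | j) h
  · rfl
  · exact absurd (φ.injective h).symm (h0 j)
  · exact absurd (φ.injective h) (h0 i)
  · exact congrArg some (Fin.ext (hα.pow_inj i.2 j.2 (φ.injective h)))

/-- The punctured Reed-Muller code `R(r, m)^*`, in cyclic coordinates: the coordinate at the zero
vector is deleted, and coordinate `i` is the value at `α^i`. -/
noncomputable def puncturedReedMuller (r : ℕ) (φ : K ≃ₗ[ZMod 2] (Fin m → ZMod 2)) (α : K) :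
    Submodule (ZMod 2) (Fin (2 ^ m - 1) → ZMod 2) :=
  (reedMuller r m).map (LinearMap.funLeft (ZMod 2) (ZMod 2) fun i => position φ α (some i))

/-- The code obtained by extending the cyclic code `I` of length `2^m - 1`, as a code with
coordinates in `{0,1}^m`. -/
noncomputable def extendedCyclicCode (φ : K ≃ₗ[ZMod 2] (Fin m → ZMod 2)) (α : K)
    (I : Ideal (CyclicRing (2 ^ m - 1))) : Submodule (ZMod 2) ((Fin m → ZMod 2) → ZMod 2) :=
  (extendedCode (cyclicCode I)).comap (LinearMap.funLeft (ZMod 2) (ZMod 2) (position φ α))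

end coordinates

/-- The element `θ_0 + θ_1^* + ∑_{j=d}^{t+1} θ_{1+2^j}^*` of `R_n`, where `n = 2^(2t+2) - 1`. -/
noncomputable def subcodeIdempotent {K : Type*} [Field K] [Algebra (ZMod 2) K] (t d : ℕ) (α : K) :
    CyclicRing (2 ^ (2 * t + 2) - 1) :=
  theta α 0 + thetaStar α 1 + ∑ j ∈ Finset.Icc d (t + 1), thetaStar α (1 + 2 ^ j)

/-!
Let `K = GF(2^m)` with `m = 2t + 2` and `n = 2^m - 1`. The cosets of `0`, `1` and `1 + 2^s` for
`d ≤ s ≤ t + 1` are pairwise disjoint, and together they consist of the numbers of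
`exponentSet m d`: `0`, the powers of two, and the sums of two powers of two whose exponents are at
cyclic distance at least `d`. Hence the given sum of idempotents takes the value `1` at `α^j`
exactly for `-j` in this set (`aeval_subcodePolynomial`), the dimension of the code is the size of
the set (`finrank_cyclicCode_span`, `card_exponentSet`), and by Fourier inversion the words of the
extended code are the functions `f : K → GF(2)` that are combinations over `K` of the monomials
`x^u` with `u` in the set (`mem_extendedCyclicCode_span_iff`). Such functions are quadratic over
`GF(2)`, which gives the inclusion in the Reed-Muller code (`mem_reedMuller_of_eq_sum`).

For the weights, let `B` be the polar form of `f`. The square of `∑ (-1)^f(x)` equals `2^m` times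
the sum of `(-1)^(f(u) + f(0))` over the radical of `B` (`signSum_sq`). So the sum is `0` or, with
`2h` the rank of `B`, it is `±2^(m - h)` (`signSum_eq_zero`, `signSum_eq_or`), and the weights are
as claimed once `h ≥ d` is known for `B ≠ 0`. This holds because, after a power of the Frobenius
map, the radical consists of zeros of a nonzero linearized polynomial of degree at most
`2^(m - 2d)` (`card_radical_le`, `exists_polar`).

It remains to see that every `h` between `d` and `t + 1` occurs. Write `x ↦ x̄` for the involution
`x ↦ x^(2^(m/2))`, put `r = m/2 - h`, and take an `r`-dimensional subspace `W` of the fixed field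
of the involution. It is totally isotropic for the nondegenerate alternating form
`⟨x, y⟩ = Tr(x ȳ)`. Counting equations and unknowns gives a nonzero map
`M x = ∑_{i ≤ r} (μ_i x)^(2^i)` with image in `W^⊥`. Its kernel has dimension at most `r`, so the
image is all of `W^⊥`, which contains `W`, and the form `⟨M x, M y⟩` has the radical `M⁻¹(W)`, of
dimension `2r` (`exists_linearizedMap_radical`). It is the polar form of the trace, from the fixed
field, of `M x` times its conjugate, whose monomials all lie in `exponentSet m h`
(`exists_quadratic`). Adding a linear function makes it vanish on the radical
(`exists_signSum_eq`); the resulting word and its complement have the two weights that belong to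
`h`.
-/

/-! ### Exponents of binary weight at most two and cyclotomic cosets -/

/-- The exponents of the monomials that occur in the words of the code: `0`, the powers `2^k` with
`k < m`, and the sums `2^a + 2^b` with `a < b < m` whose cyclic distance modulo `m` is at least
`d`. -/
def exponentSet (m d : ℕ) : Finset ℕ :=
  {0} ∪ (Finset.range m).image (fun k => 2 ^ k) ∪
    ((Finset.range m ×ˢ Finset.range m).filter
      fun p => p.1 + d ≤ p.2 ∧ p.2 + d ≤ p.1 + m).image fun p => 2 ^ p.1 + 2 ^ p.2

theorem mem_exponentSet {m d u : ℕ} : u ∈ exponentSet m d ↔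
    u = 0 ∨ (∃ k < m, u = 2 ^ k) ∨
      ∃ a b, b < m ∧ a + d ≤ b ∧ b + d ≤ a + m ∧ u = 2 ^ a + 2 ^ b := by
  simp only [exponentSet, Finset.mem_union, Finset.mem_singleton, Finset.mem_image,
    Finset.mem_range, Finset.mem_filter, Finset.mem_product, Prod.exists, or_assoc]
  refine or_congr Iff.rfl (or_congr ?_ ?_)
  · exact exists_congr fun k => and_congr Iff.rfl eq_comm
  · refine exists_congr fun a => exists_congr fun b => ?_
    constructor
    · rintro ⟨⟨⟨-, hb⟩, h1, h2⟩, rfl⟩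
      exact ⟨hb, h1, h2, rfl⟩
    · rintro ⟨hb, h1, h2, rfl⟩
      exact ⟨⟨⟨by omega, hb⟩, h1, h2⟩, rfl⟩

theorem log_two_pow_add_two_pow {a b : ℕ} (h : a < b) : Nat.log 2 (2 ^ a + 2 ^ b) = b := by
  have h1 : 2 ^ a < 2 ^ b := Nat.pow_lt_pow_right (by norm_num) h
  refine Nat.log_eq_of_pow_le_of_lt_pow (Nat.le_add_left _ _) ?_
  rw [pow_succ (n := b)]
  omega

theorem two_pow_add_two_pow_inj {a b a' b' : ℕ} (h : a < b) (h' : a' < b')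
    (he : 2 ^ a + 2 ^ b = 2 ^ a' + 2 ^ b') : a = a' ∧ b = b' := by
  have hb : b = b' := by
    rw [← log_two_pow_add_two_pow h, he, log_two_pow_add_two_pow h']
  subst hb
  exact ⟨Nat.pow_right_injective le_rfl (by simpa using he), rfl⟩

theorem two_pow_add_two_pow_ne_two_pow {a b k : ℕ} (h : a < b) : 2 ^ a + 2 ^ b ≠ 2 ^ k := by
  intro he
  have hb : b = k := by
    rw [← log_two_pow_add_two_pow h, he, Nat.log_pow (by norm_num)]
  subst hb
  have : 0 < 2 ^ a := by positivity
  omega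

theorem two_pow_lt {m k : ℕ} (hm : 2 ≤ m) (hk : k < m) : 2 ^ k < 2 ^ m - 1 := by
  obtain ⟨r, rfl⟩ : ∃ r, m = r + 2 := ⟨m - 2, by omega⟩
  have h1 : 2 ^ k ≤ 2 ^ (r + 1) := Nat.pow_le_pow_right (by norm_num) (by omega)
  have h2 : 0 < 2 ^ r := by positivity
  rw [pow_succ] at h1 ⊢
  rw [pow_succ]
  omega

theorem two_pow_add_two_pow_lt {m a b : ℕ} (hm : 3 ≤ m) (hab : a < b) (hb : b < m) :
    2 ^ a + 2 ^ b < 2 ^ m - 1 := by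
  obtain ⟨r, rfl⟩ : ∃ r, m = r + 3 := ⟨m - 3, by omega⟩
  have h1 : 2 ^ a ≤ 2 ^ (r + 1) := Nat.pow_le_pow_right (by norm_num) (by omega)
  have h2 : 2 ^ b ≤ 2 ^ (r + 2) := Nat.pow_le_pow_right (by norm_num) (by omega)
  have h3 : 0 < 2 ^ r := by positivity
  have e1 : 2 ^ (r + 1) = 2 * 2 ^ r := by ring
  have e2 : 2 ^ (r + 2) = 4 * 2 ^ r := by ring
  have e3 : 2 ^ (r + 3) = 8 * 2 ^ r := by ring
  omega

theorem lt_of_mem_exponentSet {m d u : ℕ} (hm : 3 ≤ m) (hd : 1 ≤ d) (hu : u ∈ exponentSet m d) :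
    u < 2 ^ m - 1 := by
  rcases mem_exponentSet.1 hu with rfl | ⟨k, hk, rfl⟩ | ⟨a, b, hb, h1, h2, rfl⟩
  · have := two_pow_lt (by omega : 2 ≤ m) (by omega : 0 < m)
    omega
  · exact two_pow_lt (by omega) hk
  · exact two_pow_add_two_pow_lt hm (by omega) hb

/-- For each distance `s` between `d` and `m - d` there are `m - s` pairs, and the distances `s`
and `m - s` together contribute `m`. -/
theorem card_exponentSet {t d : ℕ} (hd : 1 ≤ d) (hdt : d ≤ t + 1) :
    (exponentSet (2 * t + 2) d).card = (2 * t + 2) * (t + 2 - d) + (2 * t + 2) / 2 + 1 := by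
  set m := 2 * t + 2 with hm
  set P := (Finset.range m ×ˢ Finset.range m).filter
      (fun p : ℕ × ℕ => p.1 + d ≤ p.2 ∧ p.2 + d ≤ p.1 + m) with hP
  have hPcard : P.card = (m - 2 * d + 1) * (t + 1) := by
    have e1 : P.card = ∑ s ∈ Finset.Icc d (m - d), (m - s) := by
      have : P.card = ((Finset.Icc d (m - d)).sigma fun s => Finset.range (m - s)).card := by
        refine Finset.card_bij' (fun p _ => ⟨p.2 - p.1, p.1⟩) (fun q _ => (q.2, q.2 + q.1))
          ?_ ?_ ?_ ?_
        · rintro ⟨a, b⟩ h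
          simp only [hP, Finset.mem_filter, Finset.mem_product, Finset.mem_range] at h
          simp only [Finset.mem_sigma, Finset.mem_Icc, Finset.mem_range]
          omega
        · rintro ⟨s, a⟩ h
          simp only [Finset.mem_sigma, Finset.mem_Icc, Finset.mem_range] at h
          simp only [hP, Finset.mem_filter, Finset.mem_product, Finset.mem_range]
          omega
        · rintro ⟨a, b⟩ h
          simp only [hP, Finset.mem_filter, Finset.mem_product, Finset.mem_range] at h
          simp only [Prod.mk.injEq, true_and]
          omega
        · rintro ⟨s, a⟩ h
          simp
      rw [this, Finset.card_sigma]
      simp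
    have e2 : ∑ s ∈ Finset.Icc d (m - d), (m - s) = ∑ s ∈ Finset.Icc d (m - d), s := by
      refine Finset.sum_bij' (fun s _ => m - s) (fun s _ => m - s) ?_ ?_ ?_ ?_ ?_ <;>
        intro s hs <;> simp only [Finset.mem_Icc] at hs ⊢ <;> omega
    have e3 : ∑ s ∈ Finset.Icc d (m - d), (m - s) + ∑ s ∈ Finset.Icc d (m - d), s
        = (m - 2 * d + 1) * m := by
      rw [← Finset.sum_add_distrib, Finset.sum_congr rfl (g := fun _ => m)]
      · simp only [Finset.sum_const, Nat.card_Icc, smul_eq_mul]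
        congr 1
        omega
      · intro s hs
        simp only [Finset.mem_Icc] at hs
        omega
    have e4 : 2 * P.card = 2 * ((m - 2 * d + 1) * (t + 1)) := by
      rw [two_mul, e1]
      nth_rewrite 2 [e2]
      rw [e3, hm]
      ring
    omega
  have himg2 : (P.image fun p => 2 ^ p.1 + 2 ^ p.2).card = P.card := by
    refine Finset.card_image_of_injOn ?_
    rintro ⟨a, b⟩ h ⟨a', b'⟩ h' he
    simp only [hP, Finset.coe_filter, Finset.mem_product, Finset.mem_range, Set.mem_ofPred_eq]
      at h h'
    obtain ⟨rfl, rfl⟩ := two_pow_add_two_pow_inj (by omega) (by omega) he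
    rfl
  have himg1 : ((Finset.range m).image fun k => 2 ^ k).card = m := by
    rw [Finset.card_image_of_injective _ (Nat.pow_right_injective le_rfl), Finset.card_range]
  have hd1 : Disjoint ({0} : Finset ℕ) ((Finset.range m).image fun k => 2 ^ k) := by
    simp
  have hd2 : Disjoint ({0} ∪ (Finset.range m).image fun k => 2 ^ k)
      (P.image fun p => 2 ^ p.1 + 2 ^ p.2) := by
    rw [Finset.disjoint_right]
    intro u hu hu'
    obtain ⟨⟨a, b⟩, h, rfl⟩ := Finset.mem_image.1 hu
    simp only [hP, Finset.mem_filter, Finset.mem_product, Finset.mem_range] at h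
    rcases Finset.mem_union.1 hu' with h0 | h1
    · simp at h0
    · obtain ⟨k, -, hk⟩ := Finset.mem_image.1 h1
      exact two_pow_add_two_pow_ne_two_pow (by omega) hk.symm
  rw [exponentSet, Finset.card_union_of_disjoint hd2, Finset.card_union_of_disjoint hd1, himg1,
    himg2, hPcard, Finset.card_singleton]
  obtain ⟨c, hc⟩ : ∃ c, t + 1 = d + c := ⟨t + 1 - d, by omega⟩
  have h1 : m - 2 * d + 1 = 2 * c + 1 := by omega
  have h2 : t + 2 - d = c + 1 := by omega
  have h3 : m / 2 = d + c := by omega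
  have h4 : m = 2 * (d + c) := by omega
  rw [h1, h2, h3, h4, hc]
  ring

theorem neg_mem_cyclotomicCoset_neg {n : ℕ} {s j : ZMod n} :
    j ∈ cyclotomicCoset (-s) ↔ -j ∈ cyclotomicCoset s := by
  simp only [cyclotomicCoset, Set.mem_range]
  refine exists_congr fun k => ?_
  rw [mul_neg, neg_eq_iff_eq_neg]

theorem two_pow_eq_one {m : ℕ} : (2 : ZMod (2 ^ m - 1)) ^ m = 1 := by
  have h : ((2 ^ m - 1 : ℕ) : ZMod (2 ^ m - 1)) = 0 := ZMod.natCast_self _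
  rw [Nat.cast_sub Nat.one_le_two_pow] at h
  push_cast at h
  exact sub_eq_zero.1 h

theorem two_pow_mod {m : ℕ} (k : ℕ) :
    (2 : ZMod (2 ^ m - 1)) ^ k = 2 ^ (k % m) := by
  conv_lhs => rw [← Nat.div_add_mod k m, pow_add, pow_mul, two_pow_eq_one, one_pow, one_mul]

theorem eq_of_natCast_eq {n u v : ℕ} (hu : u < n) (hv : v < n) (h : (u : ZMod n) = v) : u = v := by
  rw [ZMod.natCast_eq_natCast_iff', Nat.mod_eq_of_lt hu, Nat.mod_eq_of_lt hv] at h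
  exact h

section cosets

variable {m u : ℕ}

theorem natCast_mem_cyclotomicCoset_zero (hu : u < 2 ^ m - 1) :
    (u : ZMod (2 ^ m - 1)) ∈ cyclotomicCoset (0 : ZMod (2 ^ m - 1)) ↔ u = 0 := by
  simp only [cyclotomicCoset, mul_zero, Set.mem_range, exists_const]
  constructor
  · intro h
    exact eq_of_natCast_eq hu (by omega) (by simpa using h.symm)
  · rintro rfl
    simp

theorem natCast_mem_cyclotomicCoset_one (hm : 2 ≤ m) (hu : u < 2 ^ m - 1) :
    (u : ZMod (2 ^ m - 1)) ∈ cyclotomicCoset (1 : ZMod (2 ^ m - 1)) ↔ ∃ k < m, u = 2 ^ k := by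
  simp only [cyclotomicCoset, mul_one, Set.mem_range]
  constructor
  · rintro ⟨k, hk⟩
    have hlt : k % m < m := Nat.mod_lt _ (by omega)
    refine ⟨k % m, hlt, eq_of_natCast_eq hu (two_pow_lt hm hlt) ?_⟩
    rw [← hk, two_pow_mod]
    push_cast
    rfl
  · rintro ⟨k, -, rfl⟩
    exact ⟨k, by push_cast; rfl⟩

theorem natCast_mem_cyclotomicCoset_one_add {s : ℕ} (hm : 3 ≤ m) (hs : 1 ≤ s) (hsm : s < m)
    (hu : u < 2 ^ m - 1) :
    (u : ZMod (2 ^ m - 1)) ∈ cyclotomicCoset (1 + 2 ^ s : ZMod (2 ^ m - 1)) ↔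
      ∃ a b, a < b ∧ b < m ∧ (b = a + s ∨ b + s = a + m) ∧ u = 2 ^ a + 2 ^ b := by
  simp only [cyclotomicCoset, Set.mem_range]
  constructor
  · rintro ⟨k, hk⟩
    have hlt : k % m < m := Nat.mod_lt _ (by omega)
    rw [two_pow_mod, mul_add, mul_one, ← pow_add] at hk
    by_cases h : k % m + s < m
    · refine ⟨k % m, k % m + s, by omega, h, Or.inl rfl,
        eq_of_natCast_eq hu (two_pow_add_two_pow_lt hm (by omega) h) ?_⟩
      rw [← hk]
      push_cast
      rfl
    · refine ⟨k % m + s - m, k % m, by omega, hlt, Or.inr (by omega),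
        eq_of_natCast_eq hu (two_pow_add_two_pow_lt hm (by omega) hlt) ?_⟩
      rw [← hk]
      have h1 : k % m + s = (k % m + s - m) + m := by omega
      rw [h1, pow_add _ _ m, two_pow_eq_one]
      push_cast
      rw [mul_one, Nat.add_sub_cancel, add_comm]
  · rintro ⟨a, b, -, -, rfl | h, rfl⟩
    · exact ⟨a, by push_cast; ring⟩
    · refine ⟨b, ?_⟩
      rw [mul_add, mul_one, ← pow_add, h, pow_add, two_pow_eq_one]
      push_cast
      ring

end cosets

/-! ### The idempotent and the nonzeros of the code -/

/-- The polynomial of degree `< n` that represents `subcodeIdempotent`. -/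
noncomputable def subcodePolynomial {K : Type*} [Field K] [Algebra (ZMod 2) K] (t d : ℕ) (α : K) :
    (ZMod 2)[X] :=
  primitiveIdempotent α (0 : ZMod (2 ^ (2 * t + 2) - 1)) +
    primitiveIdempotent α (-1 : ZMod (2 ^ (2 * t + 2) - 1)) +
    ∑ j ∈ Finset.Icc d (t + 1), primitiveIdempotent α (-(1 + 2 ^ j) : ZMod (2 ^ (2 * t + 2) - 1))

theorem mk_subcodePolynomial {K : Type*} [Field K] [Algebra (ZMod 2) K] (t d : ℕ) (α : K) :
    Ideal.Quotient.mk _ (subcodePolynomial t d α) = subcodeIdempotent t d α := by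
  simp only [subcodePolynomial, subcodeIdempotent, thetaStar, theta, map_add, map_sum]

section

variable {K : Type*} [Field K] [Algebra (ZMod 2) K]

open Classical in
/-- The cosets of `0`, `1` and `1 + 2^s`, `d ≤ s ≤ t + 1`, are pairwise disjoint and their union
is the set of residues of `exponentSet`. -/
theorem aeval_subcodePolynomial {t d : ℕ} (ht : 1 ≤ t) (hd : 1 ≤ d) (hdt : d ≤ t + 1) {α : K}
    (hα : IsPrimitiveRoot α (2 ^ (2 * t + 2) - 1)) (j : ℕ) :
    aeval (α ^ j) (subcodePolynomial t d α) =
      if ∃ u ∈ exponentSet (2 * t + 2) d, 2 ^ (2 * t + 2) - 1 ∣ j + u then 1 else 0 := by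
  obtain ⟨m, hm⟩ : ∃ m, m = 2 * t + 2 := ⟨_, rfl⟩
  have hm3 : 3 ≤ m := by omega
  have hn : 0 < 2 ^ m - 1 := by
    have := two_pow_lt (by omega : 2 ≤ m) (by omega : 0 < m)
    omega
  have : NeZero (2 ^ m - 1) := ⟨hn.ne'⟩
  obtain ⟨u, hu, huj⟩ : ∃ u : ℕ, u < 2 ^ m - 1 ∧ (u : ZMod (2 ^ m - 1)) = -(j : ZMod (2 ^ m - 1)) :=
    ⟨_, ZMod.val_lt (-(j : ZMod (2 ^ m - 1))), ZMod.natCast_zmod_val _⟩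
  have hE : (∃ v ∈ exponentSet m d, 2 ^ m - 1 ∣ j + v) ↔ u ∈ exponentSet m d := by
    have key : ∀ v : ℕ, 2 ^ m - 1 ∣ j + v ↔ (v : ZMod (2 ^ m - 1)) = u := by
      intro v
      rw [← ZMod.natCast_eq_zero_iff, huj, Nat.cast_add, add_comm, add_eq_zero_iff_eq_neg]
    constructor
    · rintro ⟨v, hv, h⟩
      rwa [← eq_of_natCast_eq (lt_of_mem_exponentSet hm3 hd hv) hu ((key v).1 h)]
    · intro h
      exact ⟨u, h, (key u).2 rfl⟩
  have hval : ∀ s : ZMod (2 ^ m - 1), aeval (α ^ j) (primitiveIdempotent α (-s)) =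
      if (u : ZMod (2 ^ m - 1)) ∈ cyclotomicCoset s then (1 : K) else 0 := by
    intro s
    rw [(primitiveIdempotent_spec (α := α) hn (hm ▸ hα) (-s)).2 j, huj]
    simp only [neg_mem_cyclotomicCoset_neg]
  have hval0 := hval 0
  rw [neg_zero] at hval0
  rw [subcodePolynomial, ← hm, map_add, map_add, map_sum, hval0, hval 1]
  simp only [hval, hE, natCast_mem_cyclotomicCoset_zero hu,
    natCast_mem_cyclotomicCoset_one (by omega : 2 ≤ m) hu]
  by_cases h0 : u = 0
  · have h1 : ¬∃ k < m, u = 2 ^ k := by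
      rintro ⟨k, -, hk⟩
      exact pow_ne_zero k two_ne_zero (hk.symm.trans h0)
    have h2 : ∀ s ∈ Finset.Icc d (t + 1),
        (u : ZMod (2 ^ m - 1)) ∉ cyclotomicCoset (1 + 2 ^ s : ZMod (2 ^ m - 1)) := by
      intro s hs
      rw [Finset.mem_Icc] at hs
      rw [natCast_mem_cyclotomicCoset_one_add hm3 (by omega) (by omega) hu]
      rintro ⟨a, b, -, -, -, h⟩
      have h4 : 0 < 2 ^ a + 2 ^ b := by positivity
      rw [← h, h0] at h4
      exact lt_irrefl _ h4
    rw [Finset.sum_congr rfl fun s hs => if_neg (h2 s hs), if_pos h0, if_neg h1,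
      if_pos (mem_exponentSet.2 (Or.inl h0))]
    simp
  by_cases h1 : ∃ k < m, u = 2 ^ k
  · have h2 : ∀ s ∈ Finset.Icc d (t + 1),
        (u : ZMod (2 ^ m - 1)) ∉ cyclotomicCoset (1 + 2 ^ s : ZMod (2 ^ m - 1)) := by
      intro s hs
      rw [Finset.mem_Icc] at hs
      rw [natCast_mem_cyclotomicCoset_one_add hm3 (by omega) (by omega) hu]
      rintro ⟨a, b, hab, -, -, h⟩
      obtain ⟨k, -, hk⟩ := h1
      exact two_pow_add_two_pow_ne_two_pow hab (h.symm.trans hk)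
    rw [Finset.sum_congr rfl fun s hs => if_neg (h2 s hs), if_neg h0, if_pos h1,
      if_pos (mem_exponentSet.2 (Or.inr (Or.inl h1)))]
    simp
  rw [if_neg h0, if_neg h1, zero_add, zero_add]
  by_cases h3 : u ∈ exponentSet m d
  · rw [if_pos h3]
    rcases mem_exponentSet.1 h3 with h | h | ⟨a, b, hb, hab, hab', rfl⟩
    · exact absurd h h0
    · exact absurd h h1
    -- the only contributing coset is the one of the cyclic distance of `a` and `b`
    rw [Finset.sum_eq_single (min (b - a) (a + m - b)), if_pos]
    · rw [natCast_mem_cyclotomicCoset_one_add hm3 (by omega) (by omega) hu]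
      exact ⟨a, b, by omega, hb, by omega, rfl⟩
    · intro s hs hne
      rw [Finset.mem_Icc] at hs
      rw [if_neg]
      rw [natCast_mem_cyclotomicCoset_one_add hm3 (by omega) (by omega) hu]
      rintro ⟨a', b', hlt, -, h, he⟩
      obtain ⟨rfl, rfl⟩ := two_pow_add_two_pow_inj (by omega) hlt he
      omega
    · intro h
      rw [Finset.mem_Icc] at h
      omega
  · rw [if_neg h3]
    refine Finset.sum_eq_zero fun s hs => if_neg ?_
    rw [Finset.mem_Icc] at hs
    rw [natCast_mem_cyclotomicCoset_one_add hm3 (by omega) (by omega) hu]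
    rintro ⟨a, b, hab, hb, h, he⟩
    exact h3 (mem_exponentSet.2 (Or.inr (Or.inr ⟨a, b, hb, by omega, by omega, he⟩)))

end

section

variable {K : Type*} [Field K] [Algebra (ZMod 2) K] {n : ℕ} {α : K}

theorem aeval_X_pow_sub_one (hα : IsPrimitiveRoot α n) (j : ℕ) :
    aeval (α ^ j) (X ^ n - 1 : (ZMod 2)[X]) = 0 := by
  rw [map_sub, map_pow, aeval_X, map_one, ← pow_mul, mul_comm, pow_mul, hα.pow_eq_one, one_pow,
    sub_self]

/-- The ring `R_n` embeds into `K^n` by evaluation at the powers of `α`. -/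
theorem mk_eq_zero_iff_aeval (hn : 0 < n) (hα : IsPrimitiveRoot α n) {p : (ZMod 2)[X]} :
    (Ideal.Quotient.mk (Ideal.span {(X ^ n - 1 : (ZMod 2)[X])}) p) = 0 ↔
      ∀ j : ℕ, aeval (α ^ j) p = 0 := by
  rw [Ideal.Quotient.eq_zero_iff_mem, Ideal.mem_span_singleton]
  constructor
  · rintro ⟨q, rfl⟩ j
    rw [map_mul, aeval_X_pow_sub_one hα, zero_mul]
  · intro h
    rw [← Polynomial.map_dvd_map' (algebraMap (ZMod 2) K), Polynomial.map_sub, Polynomial.map_pow,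
      map_X, Polynomial.map_one, X_pow_sub_one_eq_prod hn hα]
    refine Finset.prod_dvd_of_coprime ?_ ?_
    · intro a _ b _ hab
      exact isCoprime_X_sub_C_of_isUnit_sub (sub_ne_zero.2 hab).isUnit
    · intro ζ hζ
      rw [dvd_iff_isRoot, IsRoot, eval_map_algebraMap]
      have : NeZero n := ⟨hn.ne'⟩
      obtain ⟨i, -, rfl⟩ := hα.eq_pow_of_pow_eq_one ((mem_nthRootsFinset hn 1).1 hζ)
      exact h i

/-- The polynomial `c(x) = ∑ c_i x^i` of the word `c`. -/
noncomputable def wordPolynomial (c : Fin n → ZMod 2) : (ZMod 2)[X] :=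
  ∑ i : Fin n, C (c i) * X ^ (i : ℕ)

theorem aeval_wordPolynomial (c : Fin n → ZMod 2) (x : K) :
    aeval x (wordPolynomial c) = ∑ i : Fin n, algebraMap (ZMod 2) K (c i) * x ^ (i : ℕ) := by
  simp [wordPolynomial, map_sum]

theorem wordClass_eq (c : Fin n → ZMod 2) :
    wordClass n c = Ideal.Quotient.mk _ (wordPolynomial c) := rfl

theorem coeff_wordPolynomial (c : Fin n → ZMod 2) (i : Fin n) :
    (wordPolynomial c).coeff i = c i := by
  simp only [wordPolynomial, finsetSum_coeff, coeff_C_mul, coeff_X_pow]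
  rw [Finset.sum_eq_single i]
  · simp
  · intro j _ hj
    rw [if_neg (fun h => hj (Fin.ext h.symm)), mul_zero]
  · simp

theorem wordClass_bijective (hn : 0 < n) : Function.Bijective (wordClass n) := by
  have hmonic : (X ^ n - 1 : (ZMod 2)[X]).Monic := by
    rw [← C_1]
    exact monic_X_pow_sub_C _ hn.ne'
  have hdeg : (X ^ n - 1 : (ZMod 2)[X]).degree = n := by
    rw [← C_1]
    exact degree_X_pow_sub_C hn _
  constructor
  · rw [← LinearMap.ker_eq_bot, LinearMap.ker_eq_bot']
    intro c hc
    rw [wordClass_eq, Ideal.Quotient.eq_zero_iff_mem, Ideal.mem_span_singleton] at hc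
    have h0 : wordPolynomial c = 0 := by
      refine eq_zero_of_dvd_of_degree_lt hc ?_
      rw [hdeg]
      refine (degree_sum_le _ _).trans_lt ((Finset.sup_lt_iff (WithBot.bot_lt_coe n)).2 ?_)
      intro i _
      exact (degree_C_mul_X_pow_le _ _).trans_lt (WithBot.coe_lt_coe.2 i.2)
    funext i
    rw [← coeff_wordPolynomial c i, h0, coeff_zero]
    rfl
  · intro y
    obtain ⟨p, rfl⟩ := Ideal.Quotient.mk_surjective y
    refine ⟨fun i => (p %ₘ (X ^ n - 1)).coeff i, ?_⟩
    have h1 : wordPolynomial (fun i : Fin n => (p %ₘ (X ^ n - 1)).coeff i)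
        = p %ₘ (X ^ n - 1) := by
      rw [wordPolynomial, Fin.sum_univ_eq_sum_range
        (fun i => C ((p %ₘ (X ^ n - 1)).coeff i) * X ^ i) n]
      refine ((p %ₘ (X ^ n - 1)).as_sum_range_C_mul_X_pow' ?_).symm
      have h2 : (p %ₘ (X ^ n - 1)).degree < n := hdeg ▸ degree_modByMonic_lt p hmonic
      by_cases h3 : p %ₘ (X ^ n - 1) = 0
      · rw [h3, natDegree_zero]
        exact hn
      · exact (natDegree_lt_iff_degree_lt h3).2 h2
    rw [wordClass_eq, h1, Ideal.Quotient.eq, Ideal.mem_span_singleton]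
    refine ⟨-(p /ₘ (X ^ n - 1)), ?_⟩
    linear_combination modByMonic_add_div p (X ^ n - 1)

section idempotent

variable {e : (ZMod 2)[X]} {T : ℕ → Prop} [DecidablePred T]

theorem isIdempotentElem_mk_of_aeval (hn : 0 < n) (hα : IsPrimitiveRoot α n)
    (he : ∀ j : ℕ, aeval (α ^ j) e = if T j then 1 else 0) :
    IsIdempotentElem (Ideal.Quotient.mk (Ideal.span {(X ^ n - 1 : (ZMod 2)[X])}) e) := by
  rw [IsIdempotentElem, ← map_mul, ← sub_eq_zero, ← map_sub, mk_eq_zero_iff_aeval hn hα]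
  intro j
  rw [map_sub, map_mul, he]
  split_ifs <;> simp

/-- The nonzeros of the cyclic code with a given idempotent are the powers of `α` at which the
idempotent takes the value `1`. -/
theorem mem_cyclicCode_span_iff (hn : 0 < n) (hα : IsPrimitiveRoot α n)
    (he : ∀ j : ℕ, aeval (α ^ j) e = if T j then 1 else 0) {c : Fin n → ZMod 2} :
    c ∈ cyclicCode (Ideal.span {Ideal.Quotient.mk _ e} : Ideal (CyclicRing n)) ↔
      ∀ j, ¬T j → aeval (α ^ j) (wordPolynomial c) = 0 := by
  change wordClass n c ∈ Ideal.span {Ideal.Quotient.mk _ e} ↔ _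
  rw [wordClass_eq, Ideal.mem_span_singleton]
  constructor
  · rintro ⟨q, hq⟩ j hj
    obtain ⟨q, rfl⟩ := Ideal.Quotient.mk_surjective q
    rw [← map_mul, ← sub_eq_zero, ← map_sub, mk_eq_zero_iff_aeval hn hα] at hq
    have := hq j
    rwa [map_sub, map_mul, he, if_neg hj, zero_mul, sub_zero] at this
  · intro h
    refine ⟨Ideal.Quotient.mk _ (wordPolynomial c), ?_⟩
    rw [← map_mul, ← sub_eq_zero, ← map_sub, mk_eq_zero_iff_aeval hn hα]
    intro j
    rw [map_sub, map_mul, he]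
    split_ifs with hj
    · rw [one_mul, sub_self]
    · rw [h j hj, zero_mul, sub_zero]

/-- The dimension is the number of nonzeros: the code is isomorphic to `F[x]/(h)`, where the check
polynomial `h` has exactly the nonzeros as its roots, each of them simple. -/
theorem finrank_cyclicCode_span (hn : 0 < n) (hα : IsPrimitiveRoot α n)
    (he : ∀ j : ℕ, aeval (α ^ j) e = if T j then 1 else 0) :
    Module.finrank (ZMod 2)
      (cyclicCode (Ideal.span {Ideal.Quotient.mk _ e} : Ideal (CyclicRing n))) =
      ((Finset.range n).filter T).card := by
  classical
  set I : Ideal (CyclicRing n) := Ideal.span {Ideal.Quotient.mk _ e} with hI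
  let Ψ : (ZMod 2)[X] →ₗ[(ZMod 2)[X]] CyclicRing n :=
    LinearMap.toSpanSingleton _ _ (Ideal.Quotient.mk _ e)
  have hΨ : ∀ p, Ψ p = Ideal.Quotient.mk _ (p * e) := fun p => rfl
  have hker : ∀ p, p ∈ LinearMap.ker Ψ ↔ ∀ j, T j → aeval (α ^ j) p = 0 := by
    intro p
    rw [LinearMap.mem_ker, hΨ, mk_eq_zero_iff_aeval hn hα]
    refine forall_congr' fun j => ?_
    rw [map_mul, he]
    split_ifs with hj <;> simp [hj]
  have hrange : (LinearMap.range Ψ).restrictScalars (ZMod 2) = I.restrictScalars (ZMod 2) := by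
    ext y
    simp only [Submodule.restrictScalars_mem, LinearMap.mem_range, hI, Ideal.mem_span_singleton',
      hΨ, map_mul]
    constructor
    · rintro ⟨p, hp⟩
      exact ⟨_, hp⟩
    · rintro ⟨q, hq⟩
      obtain ⟨q, rfl⟩ := Ideal.Quotient.mk_surjective q
      exact ⟨q, hq⟩
  obtain ⟨h, hh⟩ : ∃ h, LinearMap.ker Ψ = Ideal.span {h} :=
    (IsPrincipalIdealRing.principal (LinearMap.ker Ψ)).principal
  have e1 : Module.finrank (ZMod 2) (cyclicCode I) =
      Module.finrank (ZMod 2) (I.restrictScalars (ZMod 2)) := by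
    let W := LinearEquiv.ofBijective (wordClass n) (wordClass_bijective hn)
    have : (cyclicCode I).map (W : (Fin n → ZMod 2) →ₗ[ZMod 2] CyclicRing n) =
        I.restrictScalars (ZMod 2) :=
      Submodule.map_comap_eq_of_surjective (wordClass_bijective hn).2 _
    rw [← this]
    exact (LinearEquiv.finrank_map_eq W _).symm
  have e2 : Module.finrank (ZMod 2) (I.restrictScalars (ZMod 2)) = h.natDegree := by
    rw [← hrange, ← finrank_quotient_span_eq_natDegree (f := h)]
    have := (Ψ.quotKerEquivRange.restrictScalars (ZMod 2)).finrank_eq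
    rw [hh] at this
    exact this.symm
  have hdvd : h ∣ X ^ n - 1 := by
    rw [← Ideal.mem_span_singleton, ← hh, hker]
    exact fun j _ => aeval_X_pow_sub_one hα j
  have hroot : ∀ j, aeval (α ^ j) h = 0 ↔ T j := by
    intro j
    constructor
    · intro h0
      by_contra hj
      have : h ∣ 1 - e := by
        rw [← Ideal.mem_span_singleton, ← hh, hker]
        intro i hi
        rw [map_sub, map_one, he, if_pos hi, sub_self]
      obtain ⟨q, hq⟩ := this
      have h1 := congrArg (aeval (α ^ j)) hq
      rw [map_sub, map_one, map_mul, h0, he, if_neg hj] at h1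
      simp at h1
    · exact (hker h).1 (hh ▸ Ideal.mem_span_singleton_self h) j
  have hne : (X ^ n - 1 : K[X]) ≠ 0 := by
    rw [← C_1]
    exact X_pow_sub_C_ne_zero hn _
  have hdvdK : h.map (algebraMap (ZMod 2) K) ∣ X ^ n - 1 := by
    have := Polynomial.map_dvd (algebraMap (ZMod 2) K) hdvd
    simpa using this
  have hneK : h.map (algebraMap (ZMod 2) K) ≠ 0 := fun h0 => hne (by
    rw [h0] at hdvdK
    exact zero_dvd_iff.1 hdvdK)
  have hsplit : (h.map (algebraMap (ZMod 2) K)).Splits :=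
    (X_pow_sub_one_splits hα).of_dvd hne hdvdK
  have hnodup : (h.map (algebraMap (ZMod 2) K)).roots.Nodup := by
    refine Multiset.nodup_of_le (roots.le_of_dvd hne hdvdK) ?_
    have := hα.nthRoots_one_nodup
    rwa [nthRoots, C_1] at this
  rw [e1, e2, ← natDegree_map (algebraMap (ZMod 2) K), hsplit.natDegree_eq_card_roots,
    ← Multiset.toFinset_card_of_nodup hnodup]
  have himg : (h.map (algebraMap (ZMod 2) K)).roots.toFinset =
      ((Finset.range n).filter T).image (α ^ ·) := by
    ext x
    rw [Multiset.mem_toFinset, mem_roots hneK, Finset.mem_image]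
    constructor
    · intro hx
      have hx1 : x ^ n = 1 := by
        have := hx.dvd hdvdK
        rw [IsRoot] at this
        simpa [sub_eq_zero] using this
      have : NeZero n := ⟨hn.ne'⟩
      obtain ⟨j, hj, rfl⟩ := hα.eq_pow_of_pow_eq_one hx1
      rw [IsRoot, eval_map_algebraMap, hroot] at hx
      exact ⟨j, Finset.mem_filter.2 ⟨Finset.mem_range.2 hj, hx⟩, rfl⟩
    · rintro ⟨j, hj, rfl⟩
      rw [IsRoot, eval_map_algebraMap, hroot]
      exact (Finset.mem_filter.1 hj).2
  rw [himg, Finset.card_image_of_injOn]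
  intro i hi j hj hij
  simp only [Finset.coe_filter, Finset.mem_range, Set.mem_ofPred_eq] at hi hj
  exact hα.pow_inj hi.1 hj.1 hij

end idempotent

end

/-! ### Words of the extended code as functions on the field -/

section

variable {K : Type*} [Field K] {α : K}

open Classical in
theorem geom_sum_of_pow_eq_one [CharP K 2] {n : ℕ} (ho : Odd n) {x : K} (hx : x ^ n = 1) :
    ∑ i ∈ Finset.range n, x ^ i = if x = 1 then 1 else 0 := by
  split_ifs with h
  · subst h
    obtain ⟨r, hr⟩ := ho
    have : (2 : K) = 0 := CharTwo.two_eq_zero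
    simp [hr, this]
  · have h3 := mul_geom_sum x n
    rw [hx, sub_self] at h3
    exact (mul_eq_zero.1 h3).resolve_left (sub_ne_zero.2 h)

variable [Algebra (ZMod 2) K]

theorem mem_extendedCyclicCode_iff {m : ℕ} {φ : K ≃ₗ[ZMod 2] (Fin m → ZMod 2)}
    {I : Ideal (CyclicRing (2 ^ m - 1))} {F : (Fin m → ZMod 2) → ZMod 2} :
    F ∈ extendedCyclicCode φ α I ↔
      (fun i : Fin (2 ^ m - 1) => F (φ (α ^ (i : ℕ)))) ∈ cyclicCode I ∧
        F (φ 0) = ∑ i : Fin (2 ^ m - 1), F (φ (α ^ (i : ℕ))) := by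
  rw [extendedCyclicCode, Submodule.mem_comap, extendedCode, Submodule.mem_map]
  constructor
  · rintro ⟨c, hc, h⟩
    have h1 : (fun i : Fin (2 ^ m - 1) => F (φ (α ^ (i : ℕ)))) = c := by
      funext i
      exact (congrFun h (some i)).symm
    have h2 : ∑ i, c i = F (φ 0) := congrFun h none
    refine ⟨h1 ▸ hc, ?_⟩
    rw [← h2, ← h1]
  · rintro ⟨hc, h0⟩
    refine ⟨_, hc, ?_⟩
    funext i
    cases i with
    | none => exact h0.symm
    | some i => rfl

variable {E : Finset ℕ}

theorem eq_of_dvd_sub_add {n a b : ℕ} (ha : a < n) (hb : b < n) (h : n ∣ n - a + b) : a = b := by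
  obtain ⟨c, hc⟩ := h
  have hc1 : c = 1 := by
    rcases Nat.lt_or_ge c 2 with h2 | h2
    · have : c ≠ 0 := by
        rintro rfl
        omega
      omega
    · have := Nat.mul_le_mul_left n h2
      omega
  subst hc1
  omega

/-- The discrete Fourier transform turns the description of a cyclic code by its nonzeros into one
by exponents: up to the position of the coordinates, the words of the extended code are the
functions on the field that are linear combinations, over the field, of the monomials `x^u` with
`u ∈ E`. -/
theorem mem_extendedCyclicCode_span_iff [CharP K 2] {m : ℕ}
    (hα : IsPrimitiveRoot α (2 ^ m - 1)) (hcard : ∀ x : K, x ≠ 0 → x ^ (2 ^ m - 1) = 1)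
    (φ : K ≃ₗ[ZMod 2] (Fin m → ZMod 2)) (hE : ∀ u ∈ E, u < 2 ^ m - 1) (h0 : 0 ∈ E)
    {e : (ZMod 2)[X]} [DecidablePred fun j : ℕ => ∃ u ∈ E, 2 ^ m - 1 ∣ j + u]
    (he : ∀ j : ℕ, aeval (α ^ j) e = if ∃ u ∈ E, 2 ^ m - 1 ∣ j + u then 1 else 0)
    {F : (Fin m → ZMod 2) → ZMod 2} :
    F ∈ extendedCyclicCode φ α (Ideal.span {Ideal.Quotient.mk _ e}) ↔
      ∃ A : ℕ → K, ∀ x, algebraMap (ZMod 2) K (F (φ x)) = ∑ u ∈ E, A u * x ^ u := by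
  classical
  rw [mem_extendedCyclicCode_iff,
    mem_cyclicCode_span_iff ((Nat.zero_le _).trans_lt (hE 0 h0)) hα he]
  simp only [aeval_wordPolynomial]
  generalize 2 ^ m - 1 = n at *
  have hn : 0 < n := (Nat.zero_le _).trans_lt (hE 0 h0)
  have : NeZero n := ⟨hn.ne'⟩
  have ho : Odd n := odd_of_isPrimitiveRoot hn hα
  have hα0 : α ≠ 0 := hα.ne_zero hn.ne'
  have hα1 : ∀ i : ℕ, (α ^ i) ^ n = 1 := fun i => by
    rw [← pow_mul, mul_comm, pow_mul, hα.pow_eq_one, one_pow]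
  constructor
  · rintro ⟨hF, hF0⟩
    let A : ℕ → K := fun u =>
      ∑ i : Fin n, algebraMap (ZMod 2) K (F (φ (α ^ (i : ℕ)))) * (α ^ (n - u)) ^ (i : ℕ)
    refine ⟨A, fun x => ?_⟩
    by_cases hx : x = 0
    · subst hx
      rw [Finset.sum_eq_single 0]
      · simp only [A, hF0, map_sum, Nat.sub_zero, hα.pow_eq_one, one_pow, mul_one, pow_zero]
      · intro u _ hu
        rw [zero_pow hu, mul_zero]
      · exact fun h => absurd h0 h
    · obtain ⟨k, hk, rfl⟩ := hα.eq_pow_of_pow_eq_one (hcard x hx)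
      have h1 : ∑ u ∈ E, A u * (α ^ k) ^ u = ∑ u ∈ Finset.range n, A u * (α ^ k) ^ u := by
        refine Finset.sum_subset (fun u hu => Finset.mem_range.2 (hE u hu)) fun u hu hu' => ?_
        have : A u = 0 := by
          refine hF (n - u) ?_
          rintro ⟨v, hv, hdvd⟩
          exact hu' (eq_of_dvd_sub_add (Finset.mem_range.1 hu) (hE v hv) hdvd ▸ hv)
        rw [this, zero_mul]
      have h2 : ∀ i u : ℕ, u < n → (α ^ (n - u)) ^ i * (α ^ k) ^ u = (α ^ k / α ^ i) ^ u := by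
        intro i u hu
        have h3 : (α ^ (n - u)) ^ i * (α ^ i) ^ u = 1 := by
          rw [← pow_mul, ← pow_mul, mul_comm i u, ← pow_add, ← add_mul, Nat.sub_add_cancel hu.le,
            pow_mul, hα.pow_eq_one, one_pow]
        rw [div_pow, eq_div_iff (pow_ne_zero _ (pow_ne_zero _ hα0)), mul_right_comm, h3, one_mul]
      rw [h1]
      simp only [A, Finset.sum_mul]
      rw [Finset.sum_comm, Finset.sum_eq_single (⟨k, hk⟩ : Fin n)]
      · rw [Finset.sum_congr rfl fun u hu => by
          rw [mul_assoc, h2 k u (Finset.mem_range.1 hu)], ← Finset.mul_sum,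
          geom_sum_of_pow_eq_one ho (by rw [div_pow, hα1, div_one]),
          if_pos (div_self (pow_ne_zero _ hα0)), mul_one]
      · intro i _ hi
        rw [Finset.sum_congr rfl fun u hu => by
          rw [mul_assoc, h2 i u (Finset.mem_range.1 hu)], ← Finset.mul_sum,
          geom_sum_of_pow_eq_one ho (by rw [div_pow, hα1, hα1, div_one]), if_neg, mul_zero]
        rw [div_eq_one_iff_eq (pow_ne_zero _ hα0)]
        exact fun h => hi (Fin.ext (hα.pow_inj hk i.2 h).symm)
      · exact fun h => absurd (Finset.mem_univ _) h
  · rintro ⟨A, hA⟩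
    have key : ∀ j : ℕ, ∑ i : Fin n, algebraMap (ZMod 2) K (F (φ (α ^ (i : ℕ)))) *
        (α ^ j) ^ (i : ℕ) = ∑ u ∈ E, if n ∣ j + u then A u else 0 := by
      intro j
      simp only [hA, Finset.sum_mul]
      rw [Finset.sum_comm]
      refine Finset.sum_congr rfl fun u _ => ?_
      have h1 : ∀ i : ℕ, A u * (α ^ i) ^ u * (α ^ j) ^ i = A u * (α ^ (j + u)) ^ i := by
        intro i
        ring
      simp only [h1]
      rw [← Finset.mul_sum, Fin.sum_univ_eq_sum_range (fun i => (α ^ (j + u)) ^ i) n,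
        geom_sum_of_pow_eq_one ho (hα1 _)]
      simp only [hα.pow_eq_one_iff_dvd, mul_ite, mul_one, mul_zero]
    refine ⟨fun j hj => ?_, ?_⟩
    · rw [key]
      exact Finset.sum_eq_zero fun u hu => if_neg fun h => hj ⟨u, hu, h⟩
    · apply (algebraMap (ZMod 2) K).injective
      have h1 := key 0
      simp only [pow_zero, one_pow, mul_one] at h1
      rw [map_sum, h1, hA]
      refine Finset.sum_congr rfl fun u hu => ?_
      rw [zero_add]
      by_cases hu0 : u = 0
      · simp [hu0]
      · rw [if_neg fun h => absurd (Nat.le_of_dvd (Nat.pos_of_ne_zero hu0) h)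
          (not_le.2 (hE u hu)), zero_pow hu0, mul_zero]

end

/-! ### Quadratic functions are words of the second order Reed-Muller code -/

section

variable {m : ℕ}

theorem const_mem_reedMuller (r : ℕ) (a : ZMod 2) : (fun _ => a) ∈ reedMuller r m :=
  ⟨MvPolynomial.C a, by simp, fun v => by simp⟩

theorem linear_mem_reedMuller {r : ℕ} (hr : 1 ≤ r) (L : (Fin m → ZMod 2) →ₗ[ZMod 2] ZMod 2) :
    (fun v => L v) ∈ reedMuller r m := by
  refine ⟨∑ i, MvPolynomial.C (L (Pi.single i 1)) * MvPolynomial.X i, ?_, fun v => ?_⟩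
  · refine MvPolynomial.totalDegree_finsetSum_le fun i _ => ?_
    exact (MvPolynomial.totalDegree_mul _ _).trans (by simpa using hr)
  · change L v = _
    rw [LinearMap.pi_apply_eq_sum_univ L v]
    simp only [map_sum, map_mul, MvPolynomial.eval_C, MvPolynomial.eval_X, smul_eq_mul]
    refine Finset.sum_congr rfl fun i _ => ?_
    rw [mul_comm]
    congr 2
    funext j
    simp [Pi.single_apply, eq_comm]

theorem bilin_mem_reedMuller
    (B : (Fin m → ZMod 2) →ₗ[ZMod 2] (Fin m → ZMod 2) →ₗ[ZMod 2] ZMod 2) :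
    (fun v => B v v) ∈ reedMuller 2 m := by
  refine ⟨∑ i, ∑ j, MvPolynomial.C (B (Pi.single i 1) (Pi.single j 1)) *
    (MvPolynomial.X i * MvPolynomial.X j), ?_, fun v => ?_⟩
  · refine MvPolynomial.totalDegree_finsetSum_le fun i _ =>
      MvPolynomial.totalDegree_finsetSum_le fun j _ => ?_
    refine (MvPolynomial.totalDegree_mul _ _).trans ?_
    have := MvPolynomial.totalDegree_mul (MvPolynomial.X i : MvPolynomial (Fin m) (ZMod 2))
      (MvPolynomial.X j)
    simp only [MvPolynomial.totalDegree_X, MvPolynomial.totalDegree_C] at this ⊢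
    omega
  · have hv : v = ∑ i, v i • (Pi.single i 1 : Fin m → ZMod 2) := by
      funext j
      simp [Finset.sum_apply, Pi.single_apply]
    change B v v = _
    conv_lhs => rw [hv]
    simp only [map_sum, map_mul, MvPolynomial.eval_C, MvPolynomial.eval_X, map_smul,
      LinearMap.sum_apply, LinearMap.smul_apply, smul_eq_mul]
    rw [Finset.sum_comm]
    refine Finset.sum_congr rfl fun i _ => ?_
    rw [Finset.mul_sum]
    refine Finset.sum_congr rfl fun j _ => ?_
    ring

end

section

/-- The `k`-th power of the Frobenius map, as a linear map over the prime field. -/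
noncomputable def frobPow (K : Type*) [Field K] [Algebra (ZMod 2) K] [CharP K 2] (k : ℕ) :
    K →ₗ[ZMod 2] K where
  toFun x := x ^ 2 ^ k
  map_add' x y := add_pow_char_pow ..
  map_smul' a x := by
    have ha : a ^ 2 ^ k = a := by
      exact ZMod.pow_card_pow a
    rw [RingHom.id_apply, _root_.smul_pow, ha]

variable {K : Type*} [Field K] [Algebra (ZMod 2) K] [CharP K 2]

@[simp]
theorem frobPow_apply (k : ℕ) (x : K) : frobPow K k x = x ^ 2 ^ k := rfl

/-- Applying to the coefficients of `∑ A_u x^u` a linear functional that fixes the prime field turns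
each monomial into a constant, a linear form or the diagonal of a bilinear form. -/
theorem mem_reedMuller_of_eq_sum {m d : ℕ} (φ : K ≃ₗ[ZMod 2] (Fin m → ZMod 2))
    {F : (Fin m → ZMod 2) → ZMod 2} {A : ℕ → K}
    (hF : ∀ x, algebraMap (ZMod 2) K (F (φ x)) = ∑ u ∈ exponentSet m d, A u * x ^ u) :
    F ∈ reedMuller 2 m := by
  obtain ⟨l, hl⟩ := (Algebra.linearMap (ZMod 2) K).exists_leftInverse_of_injective
    (LinearMap.ker_eq_bot.2 (algebraMap (ZMod 2) K).injective)
  have h1 : F = ∑ u ∈ exponentSet m d, fun v => l (A u * (φ.symm v) ^ u) := by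
    funext v
    have h2 := LinearMap.congr_fun hl (F v)
    have h3 := hF (φ.symm v)
    rw [φ.apply_symm_apply] at h3
    rw [LinearMap.comp_apply, Algebra.linearMap_apply, h3, map_sum, LinearMap.id_apply] at h2
    rw [Finset.sum_apply, ← h2]
  rw [h1]
  refine Submodule.sum_mem _ fun u hu => ?_
  rcases mem_exponentSet.1 hu with rfl | ⟨k, -, rfl⟩ | ⟨a, b, -, -, -, rfl⟩
  · simpa using const_mem_reedMuller 2 (l (A 0))
  · exact linear_mem_reedMuller (by norm_num)
      (l ∘ₗ LinearMap.mulLeft (ZMod 2) (A (2 ^ k)) ∘ₗ frobPow K k ∘ₗ φ.symm.toLinearMap)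
  · have h2 := bilin_mem_reedMuller (m := m)
      ((((LinearMap.mul (ZMod 2) K).compl₁₂ (LinearMap.mulLeft (ZMod 2) (A (2 ^ a + 2 ^ b)) ∘ₗ
        frobPow K a ∘ₗ φ.symm.toLinearMap) (frobPow K b ∘ₗ φ.symm.toLinearMap))).compr₂ l)
    convert h2 using 2 with v
    simp [pow_add, mul_assoc]

end

/-! ### Character sums of quadratic functions -/

/-- The additive character of `GF(2)` with values `1` and `-1`. -/
def signChar (a : ZMod 2) : ℤ := if a = 0 then 1 else -1

theorem signChar_add : ∀ a b : ZMod 2, signChar (a + b) = signChar a * signChar b := by decide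

theorem signChar_add_one : ∀ a : ZMod 2, signChar (a + 1) = -signChar a := by decide

theorem signChar_eq : ∀ a : ZMod 2, signChar a = 1 - 2 * if a ≠ 0 then 1 else 0 := by decide

theorem ZMod.eq_one_of_ne_zero_two : ∀ {a : ZMod 2}, a ≠ 0 → a = 1 := by decide

section

variable {V : Type*} [Fintype V]

/-- The character sum of a Boolean function: the number of zeros minus the number of ones. -/
def signSum (f : V → ZMod 2) : ℤ := ∑ x, signChar (f x)

theorem signSum_add_one (f : V → ZMod 2) : signSum (fun x => f x + 1) = -signSum f := by
  simp only [signSum, signChar_add_one, Finset.sum_neg_distrib]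

theorem signSum_eq_card_sub (f : V → ZMod 2) :
    signSum f = Fintype.card V - 2 * hammingNorm f := by
  simp only [signSum, signChar_eq, Finset.sum_sub_distrib, ← Finset.mul_sum, hammingNorm,
    Finset.card_filter]
  simp

end

theorem signSum_comp_eq {K : Type*} [Field K] [Algebra (ZMod 2) K] [Fintype K] {m : ℕ}
    (φ : K ≃ₗ[ZMod 2] (Fin m → ZMod 2)) (F : (Fin m → ZMod 2) → ZMod 2) :
    signSum (fun x => F (φ x)) = 2 ^ m - 2 * hammingNorm F := by
  have h := signSum_eq_card_sub F
  rw [signSum, ← Equiv.sum_comp φ.toEquiv] at h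
  rw [signSum]
  simpa using h

section

variable {V : Type*} [AddCommGroup V] [Module (ZMod 2) V] [Fintype V]

theorem sum_signChar_linear_of_ne_zero {L : V →ₗ[ZMod 2] ZMod 2} (hL : L ≠ 0) :
    ∑ x, signChar (L x) = 0 := by
  obtain ⟨v, hv⟩ : ∃ v, L v ≠ 0 := by
    by_contra! h
    exact hL (LinearMap.ext h)
  have h1 : ∑ x, signChar (L x) = ∑ x, signChar (L (x + v)) :=
    (Equiv.sum_comp (Equiv.addRight v) fun x => signChar (L x)).symm
  simp only [map_add, ZMod.eq_one_of_ne_zero_two hv, signChar_add_one,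
    Finset.sum_neg_distrib] at h1
  omega

variable {f : V → ZMod 2} {B : V →ₗ[ZMod 2] V →ₗ[ZMod 2] ZMod 2}

/-- Squaring the character sum of a quadratic function leaves a sum over the radical. -/
theorem signSum_sq (hf : ∀ x y, f (x + y) = f x + f y + f 0 + B x y)
    [DecidablePred (· ∈ LinearMap.ker B)] :
    signSum f ^ 2 = Fintype.card V * ∑ u : LinearMap.ker B, signChar (f u + f 0) := by
  have h2 : ∀ a b c d : ZMod 2, a + (b + a + c + d) = b + c + d := by decide
  calc signSum f ^ 2 = ∑ x, ∑ y, signChar (f x) * signChar (f y) := by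
        rw [sq, signSum, Finset.sum_mul_sum]
    _ = ∑ x, ∑ u, signChar (f x) * signChar (f (u + x)) := by
        refine Finset.sum_congr rfl fun x _ => ?_
        exact (Equiv.sum_comp (Equiv.addRight x) fun y => signChar (f x) * signChar (f y)).symm
    _ = ∑ u, signChar (f u + f 0) * ∑ x, signChar (B u x) := by
        rw [Finset.sum_comm]
        refine Finset.sum_congr rfl fun u _ => ?_
        rw [Finset.mul_sum]
        refine Finset.sum_congr rfl fun x _ => ?_
        rw [← signChar_add, hf, h2, signChar_add]
    _ = ∑ u, if u ∈ LinearMap.ker B then signChar (f u + f 0) * Fintype.card V else 0 := by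
        refine Finset.sum_congr rfl fun u _ => ?_
        split_ifs with hu
        · rw [LinearMap.mem_ker] at hu
          simp [hu, signChar]
        · rw [sum_signChar_linear_of_ne_zero (fun h => hu (LinearMap.mem_ker.2 h)), mul_zero]
    _ = Fintype.card V * ∑ u : LinearMap.ker B, signChar (f u + f 0) := by
        rw [← Finset.sum_filter, ← Finset.sum_mul, mul_comm]
        congr 1
        exact (Finset.sum_subtype _ (by simp) fun u => signChar (f u + f 0))

theorem signSum_eq_zero (hf : ∀ x y, f (x + y) = f x + f y + f 0 + B x y) {u : V}
    (hu : u ∈ LinearMap.ker B) (hfu : f u ≠ f 0) : signSum f = 0 := by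
  classical
  let L : LinearMap.ker B →ₗ[ZMod 2] ZMod 2 := AddMonoidHom.toZModLinearMap 2
    { toFun := fun v => f v + f 0
      map_zero' := CharTwo.add_self_eq_zero _
      map_add' := fun v w => by
        have h1 : B v w = 0 := by
          rw [LinearMap.mem_ker.1 v.2]
          rfl
        have h2 : ∀ a b c : ZMod 2, a + b + c + 0 + c = a + c + (b + c) := by decide
        rw [Submodule.coe_add, hf, h1, h2] }
  have hL : L ≠ 0 := by
    intro h
    have : f u + f 0 = 0 := LinearMap.congr_fun h ⟨u, hu⟩
    exact hfu (CharTwo.add_eq_zero.1 this)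
  have h := signSum_sq hf
  have h3 : ∑ v : LinearMap.ker B, signChar (f v + f 0) = 0 := sum_signChar_linear_of_ne_zero hL
  rw [h3, mul_zero] at h
  exact pow_eq_zero_iff two_ne_zero |>.1 h

/-- If a quadratic function is constant on its radical then its character sum has absolute value
`2^(m - h)`, where `m` is the dimension of the space and `2h` the rank of the polar form; that the
rank is even follows since the square of the sum is a power of two. -/
theorem signSum_eq_or (hf : ∀ x y, f (x + y) = f x + f y + f 0 + B x y)
    (hrad : ∀ u ∈ LinearMap.ker B, f u = f 0) :
    ∃ h, Module.finrank (ZMod 2) (LinearMap.ker B) + 2 * h = Module.finrank (ZMod 2) V ∧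
      (signSum f = 2 ^ (Module.finrank (ZMod 2) V - h) ∨
        signSum f = -2 ^ (Module.finrank (ZMod 2) V - h)) := by
  classical
  have h1 := signSum_sq hf
  have h2 : ∑ u : LinearMap.ker B, signChar (f u + f 0) = Fintype.card (LinearMap.ker B) := by
    rw [Finset.sum_congr rfl fun u _ => by
      rw [hrad u u.2, CharTwo.add_self_eq_zero, signChar, if_pos rfl]]
    simp
  set m := Module.finrank (ZMod 2) V with hm
  set ρ := Module.finrank (ZMod 2) (LinearMap.ker B) with hρ
  have hρm : ρ ≤ m := Submodule.finrank_le _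
  rw [h2, Module.card_eq_pow_finrank (K := ZMod 2) (V := V),
    Module.card_eq_pow_finrank (K := ZMod 2) (V := LinearMap.ker B), ZMod.card, ← hm, ← hρ] at h1
  have h3 : (signSum f).natAbs ^ 2 = 2 ^ (m + ρ) := by
    zify
    rw [sq_abs, h1, pow_add]
    push_cast
    rfl
  obtain ⟨k, -, hk⟩ := (Nat.dvd_prime_pow Nat.prime_two).1
    (h3 ▸ dvd_pow_self (signSum f).natAbs two_ne_zero)
  have h4 : k * 2 = m + ρ := by
    rw [hk, ← pow_mul] at h3
    exact Nat.pow_right_injective le_rfl h3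
  refine ⟨m - k, by omega, ?_⟩
  have h5 : m - (m - k) = k := by omega
  rw [h5]
  rcases Int.natAbs_eq (signSum f) with h | h
  · left
    rw [h, hk]
    push_cast
    rfl
  · right
    rw [h, hk]
    push_cast
    rfl

end

/-! ### The radical of the polar form -/

section

variable {K : Type*} [Field K]

/-- A nonzero linearized polynomial `∑_{i ≤ r} c_i X^(2^i)` has at most `2^r` zeros. -/
theorem card_le_of_linearized_eq_zero {r : ℕ} {c : ℕ → K} {i : ℕ} (hi : i ≤ r) (hc : c i ≠ 0)
    (Z : Finset K) (hZ : ∀ z ∈ Z, ∑ j ∈ Finset.range (r + 1), c j * z ^ 2 ^ j = 0) :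
    Z.card ≤ 2 ^ r := by
  set p : K[X] := ∑ j ∈ Finset.range (r + 1), C (c j) * X ^ 2 ^ j with hp
  have hp0 : p ≠ 0 := by
    intro h
    apply hc
    have h1 : p.coeff (2 ^ i) = c i := by
      simp only [hp, finsetSum_coeff, coeff_C_mul, coeff_X_pow,
        (Nat.pow_right_injective (le_refl 2)).eq_iff]
      simp
      omega
    rw [← h1, h, coeff_zero]
  have hdeg : p.natDegree ≤ 2 ^ r := by
    refine natDegree_sum_le_of_forall_le _ _ fun j hj => (natDegree_C_mul_X_pow_le _ _).trans ?_
    exact Nat.pow_le_pow_right (by norm_num) (by simpa [Nat.lt_succ_iff] using hj)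
  refine (card_le_degree_of_subset_roots (p := p) fun z hz => ?_).trans hdeg
  rw [mem_roots hp0, IsRoot, hp, eval_finsetSum]
  simpa using hZ z hz

variable {m : ℕ}

/-- The functions of two variables that are combinations of the monomials `x^(2^(b+s)) y^(2^b)`
with `b < m` and `d ≤ s ≤ m - d`, where `2d ≤ m`. The sum over `s` is written with the offset `d`
split off. -/
def polarSpan (K : Type*) [Field K] (m d : ℕ) : Submodule K (K → K → K) where
  carrier := {g | ∃ c : ℕ → ℕ → K, ∀ x y, g x y =
    ∑ b ∈ Finset.range m, ∑ s ∈ Finset.range (m - 2 * d + 1),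
      c b s * x ^ 2 ^ (b + d + s) * y ^ 2 ^ b}
  zero_mem' := ⟨0, fun x y => by simp⟩
  add_mem' := by
    rintro g g' ⟨c, hc⟩ ⟨c', hc'⟩
    refine ⟨c + c', fun x y => ?_⟩
    simp only [Pi.add_apply, hc, hc', ← Finset.sum_add_distrib, add_mul]
  smul_mem' := by
    rintro a g ⟨c, hc⟩
    refine ⟨a • c, fun x y => ?_⟩
    simp only [Pi.smul_apply, hc, smul_eq_mul, Finset.mul_sum, mul_assoc]

theorem monomial_mem_polarSpan {d b s : ℕ} (hb : b < m) (hs : s ≤ m - 2 * d) :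
    (fun x y : K => x ^ 2 ^ (b + d + s) * y ^ 2 ^ b) ∈ polarSpan K m d := by
  refine ⟨fun b' s' => if b' = b ∧ s' = s then 1 else 0, fun x y => ?_⟩
  rw [Finset.sum_eq_single b, Finset.sum_eq_single s]
  · simp
  · intro s' _ hs'
    simp [hs']
  · intro h
    exact absurd (Finset.mem_range.2 (by omega)) h
  · intro b' _ hb'
    simp [hb']
  · intro h
    exact absurd (Finset.mem_range.2 hb) h

theorem polar_mem_polarSpan [CharP K 2] {d : ℕ} (hcard : ∀ x : K, x ^ 2 ^ m = x) (A : ℕ → K) :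
    (fun x y => ∑ u ∈ exponentSet m d, A u * (x + y) ^ u - ∑ u ∈ exponentSet m d, A u * x ^ u -
      ∑ u ∈ exponentSet m d, A u * y ^ u + ∑ u ∈ exponentSet m d, A u * 0 ^ u) ∈
      polarSpan K m d := by
  have h1 : (fun x y => ∑ u ∈ exponentSet m d, A u * (x + y) ^ u -
      ∑ u ∈ exponentSet m d, A u * x ^ u - ∑ u ∈ exponentSet m d, A u * y ^ u +
      ∑ u ∈ exponentSet m d, A u * 0 ^ u) =
      ∑ u ∈ exponentSet m d, A u • fun x y : K => (x + y) ^ u - x ^ u - y ^ u + 0 ^ u := by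
    funext x y
    simp only [Finset.sum_apply, Pi.smul_apply, smul_eq_mul, ← Finset.sum_sub_distrib,
      ← Finset.sum_add_distrib, mul_add, mul_sub]
  rw [h1]
  refine Submodule.sum_mem _ fun u hu => Submodule.smul_mem _ _ ?_
  rcases mem_exponentSet.1 hu with rfl | ⟨k, -, rfl⟩ | ⟨a, b, hb, hab, hab', rfl⟩
  · convert (polarSpan K m d).zero_mem using 1
    funext x y
    simp
  · convert (polarSpan K m d).zero_mem using 1
    funext x y
    simp [add_pow_char_pow]
  · have h2 : a + m - b - d ≤ m - 2 * d := by omega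
    have h3 : b - a - d ≤ m - 2 * d := by omega
    convert (polarSpan K m d).add_mem (monomial_mem_polarSpan (K := K) hb h2)
      (monomial_mem_polarSpan (K := K) (by omega : a < m) h3) using 1
    funext x y
    have e1 : b + d + (a + m - b - d) = m + a := by omega
    have e2 : a + d + (b - a - d) = b := by omega
    simp only [Pi.add_apply, e1, e2]
    rw [pow_add 2 m a, pow_mul, hcard]
    have h0 : (0 : K) ^ (2 ^ a + 2 ^ b) = 0 := zero_pow (by positivity)
    rw [h0, pow_add, add_pow_char_pow, add_pow_char_pow]
    ring

/-- The coefficient of `y^(2^b)` in a function of `polarSpan` is, as a function of the `2^(b+d)`-th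
power of `x`, a linearized polynomial of degree at most `2^(m - 2d)`, so it has few zeros. -/
theorem card_radical_le [CharP K 2] [Fintype K] {d : ℕ} (hm : 0 < m)
    (hK : Fintype.card K = 2 ^ m)
    {g : K → K → K} (hg : g ∈ polarSpan K m d) (hg0 : g ≠ 0) (Z : Finset K)
    (hZ : ∀ x ∈ Z, ∀ y, g x y = 0) : Z.card ≤ 2 ^ (m - 2 * d) := by
  classical
  obtain ⟨c, hc⟩ := hg
  obtain ⟨b, hb, s, hs, hbs⟩ : ∃ b < m, ∃ s ≤ m - 2 * d, c b s ≠ 0 := by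
    by_contra! h
    apply hg0
    funext x y
    rw [hc]
    refine Finset.sum_eq_zero fun b hb => Finset.sum_eq_zero fun s hs => ?_
    rw [h b (Finset.mem_range.1 hb) s (by simpa [Nat.lt_succ_iff] using hs)]
    simp
  have h1 : ∀ x ∈ Z, ∑ s ∈ Finset.range (m - 2 * d + 1), c b s * x ^ 2 ^ (b + d + s) = 0 := by
    intro x hx
    by_contra h
    have h2 := card_le_of_linearized_eq_zero (r := m - 1) (i := b)
      (c := fun b => ∑ s ∈ Finset.range (m - 2 * d + 1), c b s * x ^ 2 ^ (b + d + s))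
      (by omega) h Finset.univ (fun y _ => by
        rw [Nat.sub_add_cancel hm, ← hZ x hx y, hc]
        simp only [Finset.sum_mul])
    rw [Finset.card_univ, hK] at h2
    exact absurd h2 (not_le.2 (Nat.pow_lt_pow_right (by norm_num) (by omega)))
  have hinj : Function.Injective fun x : K => x ^ 2 ^ (b + d) := by
    have := (iterateFrobenius K 2 (b + d)).injective
    intro x y hxy
    exact this (by simpa [iterateFrobenius_def] using hxy)
  rw [← Finset.card_image_of_injective Z hinj]
  refine card_le_of_linearized_eq_zero (c := c b) hs hbs _ fun z hz => ?_
  obtain ⟨x, hx, rfl⟩ := Finset.mem_image.1 hz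
  rw [← h1 x hx]
  refine Finset.sum_congr rfl fun j _ => ?_
  rw [← pow_mul, ← pow_add]

theorem add_of_mem_polarSpan [CharP K 2] {d : ℕ} {g : K → K → K} (hg : g ∈ polarSpan K m d)
    (x x' y y' : K) :
    g (x + x') y = g x y + g x' y ∧ g x (y + y') = g x y + g x y' := by
  obtain ⟨c, hc⟩ := hg
  simp only [hc, ← Finset.sum_add_distrib, add_pow_char_pow, mul_add, add_mul, and_self]

end

section

variable {K : Type*} [Field K] [Algebra (ZMod 2) K] [CharP K 2] {m : ℕ}

/-- The polar form of a word of the extended code, and the lower bound `2d` for its rank. -/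
theorem exists_polar [Fintype K] {d : ℕ} (hm : 0 < m) (hK : Fintype.card K = 2 ^ m)
    {f : K → ZMod 2} {A : ℕ → K}
    (hf : ∀ x, algebraMap (ZMod 2) K (f x) = ∑ u ∈ exponentSet m d, A u * x ^ u) :
    ∃ B : K →ₗ[ZMod 2] K →ₗ[ZMod 2] ZMod 2,
      (∀ x y, f (x + y) = f x + f y + f 0 + B x y) ∧
      (B ≠ 0 → Module.finrank (ZMod 2) (LinearMap.ker B) ≤ m - 2 * d) := by
  classical
  have hpow : ∀ x : K, x ^ 2 ^ m = x := fun x => hK ▸ FiniteField.pow_card x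
  set g : K → K → K := fun x y => algebraMap (ZMod 2) K (f (x + y) + f x + f y + f 0) with hg
  have hgm : g ∈ polarSpan K m d := by
    convert polar_mem_polarSpan (d := d) hpow A using 1
    funext x y
    simp only [hg, ← hf, map_add, CharTwo.sub_eq_add]
  have hinj := (algebraMap (ZMod 2) K).injective
  have hadd := fun x x' y y' => add_of_mem_polarSpan hgm x x' y y'
  simp only [hg, ← map_add, hinj.eq_iff] at hadd
  have hz1 : ∀ y, f (0 + y) + f 0 + f y + f 0 = 0 := by
    intro y
    rw [zero_add]
    generalize f y = a, f 0 = b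
    revert a b
    decide
  have hz2 : ∀ x, f (x + 0) + f x + f 0 + f 0 = 0 := by
    intro x
    rw [add_zero]
    generalize f x = a, f 0 = b
    revert a b
    decide
  let B : K →ₗ[ZMod 2] K →ₗ[ZMod 2] ZMod 2 :=
    LinearMap.mk₂ (ZMod 2) (fun x y => f (x + y) + f x + f y + f 0)
      (fun x x' y => (hadd x x' y 0).1)
      (fun a x y => by
        by_cases ha : a = 0
        · subst ha
          rw [zero_smul, zero_smul, hz1]
        · rw [ZMod.eq_one_of_ne_zero_two ha, one_smul, one_smul])
      (fun x y y' => (hadd x 0 y y').2)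
      (fun a x y => by
        by_cases ha : a = 0
        · subst ha
          rw [zero_smul, zero_smul, hz2]
        · rw [ZMod.eq_one_of_ne_zero_two ha, one_smul, one_smul])
  have hB : ∀ x y, B x y = f (x + y) + f x + f y + f 0 := fun x y => rfl
  refine ⟨B, fun x y => ?_, fun hB0 => ?_⟩
  · rw [hB]
    generalize f (x + y) = a, f x = b, f y = c, f 0 = e
    revert a b c e
    decide
  · have hgB : ∀ x y, g x y = algebraMap (ZMod 2) K (B x y) := fun x y => rfl
    have hg0 : g ≠ 0 := by
      intro h
      apply hB0
      ext x y
      apply hinj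
      rw [← hgB, h]
      simp
    have h1 := card_radical_le hm hK hgm hg0
      (Finset.univ.filter fun x => x ∈ LinearMap.ker B) (fun x hx y => by
        rw [hgB, LinearMap.mem_ker.1 (Finset.mem_filter.1 hx).2, LinearMap.zero_apply, map_zero])
    have h2 : (Finset.univ.filter fun x => x ∈ LinearMap.ker B).card =
        Fintype.card (LinearMap.ker B) := (Fintype.card_subtype _).symm
    rw [h2, Module.card_eq_pow_finrank (K := ZMod 2), ZMod.card] at h1
    exact (Nat.pow_le_pow_iff_right (by norm_num)).1 h1

end

/-! ### The trace form twisted by the involution of the field -/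

section

variable {K : Type*} [Field K] [Algebra (ZMod 2) K] [Fintype K]

theorem pow_two_pow_finrank (x : K) : x ^ 2 ^ Module.finrank (ZMod 2) K = x := by
  have h := Module.card_eq_pow_finrank (K := ZMod 2) (V := K)
  rw [ZMod.card] at h
  rw [← h, FiniteField.pow_card]

theorem algebraMap_trace_eq_sum (x : K) : algebraMap (ZMod 2) K (Algebra.trace (ZMod 2) K x) =
    ∑ i ∈ Finset.range (Module.finrank (ZMod 2) K), x ^ 2 ^ i := by
  rw [FiniteField.algebraMap_trace_eq_sum_pow]
  simp

theorem involution_involution {k : ℕ} (hk : Module.finrank (ZMod 2) K = 2 * k) (x : K) :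
    (x ^ 2 ^ k) ^ 2 ^ k = x := by
  rw [← pow_mul, ← pow_add, ← two_mul, ← hk, pow_two_pow_finrank]

variable [CharP K 2]

theorem trace_pow_two_pow (x : K) (k : ℕ) :
    Algebra.trace (ZMod 2) K (x ^ 2 ^ k) = Algebra.trace (ZMod 2) K x := by
  induction k with
  | zero => simp
  | succ k ih =>
    rw [pow_succ, pow_mul, ← ih]
    generalize x ^ 2 ^ k = z
    apply (algebraMap (ZMod 2) K).injective
    have h1 : ∀ a : ZMod 2, a ^ 2 = a := by decide
    have h2 := congrArg (fun y => y ^ 2) (algebraMap_trace_eq_sum z)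
    simp only [sum_pow_char 2, ← map_pow, h1] at h2
    rw [h2, algebraMap_trace_eq_sum]
    refine Finset.sum_congr rfl fun i _ => ?_
    rw [← pow_mul, ← pow_mul, mul_comm]

/-- The bilinear form `(x, y) ↦ Tr(x y^(2^k))`. For a field of degree `2k` the second factor is the
image of `y` under the involution of the field. -/
noncomputable def twistedTraceForm (K : Type*) [Field K] [Algebra (ZMod 2) K] [CharP K 2] (k : ℕ) :
    LinearMap.BilinForm (ZMod 2) K :=
  (Algebra.traceForm (ZMod 2) K).compl₂ (frobPow K k)

omit [Fintype K] in
theorem twistedTraceForm_apply (k : ℕ) (x y : K) :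
    twistedTraceForm K k x y = Algebra.trace (ZMod 2) K (x * y ^ 2 ^ k) := rfl

variable {k : ℕ}

theorem twistedTraceForm_comm (hk : Module.finrank (ZMod 2) K = 2 * k) (x y : K) :
    twistedTraceForm K k x y = twistedTraceForm K k y x := by
  rw [twistedTraceForm_apply, ← trace_pow_two_pow _ k, mul_pow, involution_involution hk,
    mul_comm, twistedTraceForm_apply]

theorem twistedTraceForm_isRefl (hk : Module.finrank (ZMod 2) K = 2 * k) :
    (twistedTraceForm K k).IsRefl := fun x y h => by
  rwa [twistedTraceForm_comm hk]

theorem twistedTraceForm_nondegenerate (hk : Module.finrank (ZMod 2) K = 2 * k) :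
    (twistedTraceForm K k).Nondegenerate := by
  have hleft : (twistedTraceForm K k).SeparatingLeft := by
    intro x hx
    refine (traceForm_nondegenerate (ZMod 2) K).1 x fun y => ?_
    have h := hx (y ^ 2 ^ k)
    rwa [twistedTraceForm_apply, involution_involution hk] at h
  refine ⟨hleft, fun y hy => hleft y fun x => ?_⟩
  rw [twistedTraceForm_comm hk]
  exact hy x

/-- The subfield of index two is totally isotropic for the twisted trace form, so there are totally
isotropic subspaces of every dimension up to `k`, spanned by elements of that subfield. -/
theorem exists_isotropic_family (hk : Module.finrank (ZMod 2) K = 2 * k) {r : ℕ} (hr : r ≤ k) :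
    ∃ w : Fin r → K, LinearIndependent (ZMod 2) w ∧ (∀ i, w i ^ 2 ^ k = w i) ∧
      ∀ i j, Algebra.trace (ZMod 2) K (w i * w j) = 0 := by
  set N : K →ₗ[ZMod 2] K := frobPow K k - LinearMap.id with hN
  have hmem : ∀ x, x ∈ LinearMap.ker N ↔ x ^ 2 ^ k = x := by
    intro x
    rw [LinearMap.mem_ker, hN, LinearMap.sub_apply, sub_eq_zero]
    rfl
  -- `N ∘ N = 0`, so the kernel of `N` has at least half the dimension
  have hle : LinearMap.range N ≤ LinearMap.ker N := by
    rintro _ ⟨x, rfl⟩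
    rw [hmem, hN, LinearMap.sub_apply, LinearMap.id_apply, frobPow_apply, sub_pow_char_pow,
      involution_involution hk, CharTwo.sub_eq_add, CharTwo.sub_eq_add, add_comm]
  have h1 := LinearMap.finrank_range_add_finrank_ker N
  have h2 := Submodule.finrank_mono hle
  obtain ⟨w, hw⟩ := exists_linearIndependent_of_le_finrank
    (R := ZMod 2) (M := LinearMap.ker N) (n := r) (by omega)
  refine ⟨fun i => w i, hw.map' (LinearMap.ker N).subtype (Submodule.ker_subtype _),
    fun i => (hmem _).1 (w i).2, fun i j => ?_⟩
  apply (algebraMap (ZMod 2) K).injective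
  rw [algebraMap_trace_eq_sum, hk, two_mul, Finset.sum_range_add, map_zero]
  have h3 : ∀ i' : ℕ, ((w i : K) * w j) ^ 2 ^ (k + i') = ((w i : K) * w j) ^ 2 ^ i' := by
    intro i'
    rw [pow_add, pow_mul, mul_pow, (hmem _).1 (w i).2, (hmem _).1 (w j).2]
  simp only [h3, CharTwo.add_self_eq_zero]

/-! ### Polar forms of every rank -/

/-- The linear map `x ↦ ∑_{i ≤ r} (μ_i x)^(2^i)`. -/
noncomputable def linearizedMap {r : ℕ} (μ : Fin (r + 1) → K) : K →ₗ[ZMod 2] K :=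
  ∑ i : Fin (r + 1), frobPow K i ∘ₗ LinearMap.mulLeft (ZMod 2) (μ i)

omit [Fintype K] in
theorem linearizedMap_apply {r : ℕ} (μ : Fin (r + 1) → K) (x : K) :
    linearizedMap μ x = ∑ i : Fin (r + 1), (μ i * x) ^ 2 ^ (i : ℕ) := by
  simp [linearizedMap]

theorem finrank_ker_linearizedMap_le {r : ℕ} {μ : Fin (r + 1) → K} (hμ : μ ≠ 0) :
    Module.finrank (ZMod 2) (LinearMap.ker (linearizedMap μ)) ≤ r := by
  classical
  obtain ⟨i, hi⟩ := Function.ne_iff.1 hμ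
  have h1 := card_le_of_linearized_eq_zero (r := r) (i := i) (by omega)
    (c := fun j => if h : j < r + 1 then μ ⟨j, h⟩ ^ 2 ^ j else 0)
    (by
      rw [dif_pos i.2]
      exact pow_ne_zero _ hi)
    (Finset.univ.filter fun x => x ∈ LinearMap.ker (linearizedMap μ)) (fun z hz => by
      have h2 := (Finset.mem_filter.1 hz).2
      rw [LinearMap.mem_ker, linearizedMap_apply] at h2
      rw [Finset.sum_range, ← h2]
      refine Finset.sum_congr rfl fun j _ => ?_
      rw [dif_pos j.2, mul_pow])
  have h2 : (Finset.univ.filter fun x => x ∈ LinearMap.ker (linearizedMap μ)).card =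
      Fintype.card (LinearMap.ker (linearizedMap μ)) := (Fintype.card_subtype _).symm
  rw [h2, Module.card_eq_pow_finrank (K := ZMod 2), ZMod.card] at h1
  exact (Nat.pow_le_pow_iff_right (by norm_num)).1 h1

/-- The requirement that the image of `linearizedMap μ` is orthogonal to `r` given elements is a
system of `r` linear equations in the `r + 1` unknowns `μ_i`. -/
theorem exists_linearizedMap_orthogonal {r : ℕ} (hr : r ≤ Module.finrank (ZMod 2) K)
    (w : Fin r → K) :
    ∃ μ : Fin (r + 1) → K, μ ≠ 0 ∧
      ∀ j x, Algebra.trace (ZMod 2) K (w j * linearizedMap μ x) = 0 := by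
  set m := Module.finrank (ZMod 2) K with hm
  let S : (Fin (r + 1) → K) →ₗ[K] (Fin r → K) :=
    (Matrix.of fun (j : Fin r) (i : Fin (r + 1)) => w j ^ 2 ^ (m - i : ℕ)).mulVecLin
  have hS : LinearMap.ker S ≠ ⊥ := LinearMap.ker_ne_bot_of_finrank_lt (by simp)
  obtain ⟨μ, hμ, hμ0⟩ := Submodule.exists_mem_ne_zero_of_ne_bot hS
  refine ⟨μ, hμ0, fun j x => ?_⟩
  have h1 : ∑ i : Fin (r + 1), w j ^ 2 ^ (m - i : ℕ) * μ i = 0 :=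
    congrFun (LinearMap.mem_ker.1 hμ) j
  have h2 : ∀ i : Fin (r + 1), Algebra.trace (ZMod 2) K (w j * (μ i * x) ^ 2 ^ (i : ℕ)) =
      Algebra.trace (ZMod 2) K (w j ^ 2 ^ (m - i : ℕ) * μ i * x) := by
    intro i
    have hi : (i : ℕ) + (m - i) = m := by omega
    rw [← trace_pow_two_pow _ (m - i : ℕ), mul_pow, ← pow_mul, ← pow_add, hi, hm,
      pow_two_pow_finrank, mul_assoc]
  rw [linearizedMap_apply, Finset.mul_sum, map_sum]
  simp only [h2]
  rw [← map_sum, ← Finset.sum_mul, h1, zero_mul, map_zero]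

/-- If `W` is totally isotropic of dimension `r` and `M` has its image in `W^⊥` and a kernel of
dimension at most `r`, then the image of `M` is `W^⊥`, which contains `W`, and the radical of
`(x, y) ↦ ⟨M x, M y⟩` is the preimage of `W`. -/
theorem exists_linearizedMap_radical (hk : Module.finrank (ZMod 2) K = 2 * k) {r : ℕ}
    (hr : r ≤ k) :
    ∃ μ : Fin (r + 1) → K, Module.finrank (ZMod 2) (LinearMap.ker
      ((twistedTraceForm K k).compl₁₂ (linearizedMap μ) (linearizedMap μ))) = 2 * r := by
  obtain ⟨w, hw, hwfix, hwiso⟩ := exists_isotropic_family hk hr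
  obtain ⟨μ, hμ0, hμ⟩ := exists_linearizedMap_orthogonal (K := K) (r := r) (by omega) w
  refine ⟨μ, ?_⟩
  set M := linearizedMap μ with hM
  set β := twistedTraceForm K k with hβ
  have hnd : β.Nondegenerate := twistedTraceForm_nondegenerate hk
  have hrefl : β.IsRefl := twistedTraceForm_isRefl hk
  set W := Submodule.span (ZMod 2) (Set.range w) with hW
  have hWr : Module.finrank (ZMod 2) W = r := by
    rw [hW, finrank_span_eq_card hw, Fintype.card_fin]
  have hbw : ∀ j y, β (w j) y = Algebra.trace (ZMod 2) K (w j * y) := by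
    intro j y
    rw [hβ, twistedTraceForm_comm hk, twistedTraceForm_apply, hwfix, mul_comm]
  have horth : ∀ y, (∀ j, Algebra.trace (ZMod 2) K (w j * y) = 0) → y ∈ β.orthogonal W := by
    intro y hy
    rw [LinearMap.BilinForm.mem_orthogonal_iff]
    have : W ≤ LinearMap.ker (LinearMap.flip β y) := by
      rw [hW, Submodule.span_le]
      rintro _ ⟨j, rfl⟩
      exact (hbw j y).trans (hy j)
    exact fun x hx => this hx
  have hWW : W ≤ β.orthogonal W := by
    rw [hW, Submodule.span_le, ← hW]
    rintro _ ⟨j, rfl⟩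
    exact horth _ fun i => hwiso i j
  have hMW : LinearMap.range M ≤ β.orthogonal W := by
    rintro _ ⟨x, rfl⟩
    exact horth _ fun j => hμ j x
  have hker : Module.finrank (ZMod 2) (LinearMap.ker M) ≤ r := finrank_ker_linearizedMap_le hμ0
  have hsum := LinearMap.finrank_range_add_finrank_ker M
  have hWperp : Module.finrank (ZMod 2) (β.orthogonal W) = 2 * k - r := by
    rw [LinearMap.BilinForm.finrank_orthogonal hnd, hk, hWr]
  have hrange : LinearMap.range M = β.orthogonal W :=
    Submodule.eq_of_le_of_finrank_le hMW (by omega)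
  have hkerr : Module.finrank (ZMod 2) (LinearMap.ker M) = r := by
    rw [hrange] at hsum
    omega
  have hrad : LinearMap.ker (β.compl₁₂ M M) = W.comap M := by
    ext x
    rw [Submodule.mem_comap, ← LinearMap.BilinForm.orthogonal_orthogonal hnd hrefl W, ← hrange,
      LinearMap.BilinForm.mem_orthogonal_iff, LinearMap.mem_ker]
    constructor
    · rintro hx _ ⟨y, rfl⟩
      exact hrefl _ _ (LinearMap.congr_fun hx y)
    · intro hx
      ext y
      exact hrefl _ _ (hx (M y) ⟨y, rfl⟩)
  have hle : LinearMap.ker M ≤ W.comap M := LinearMap.ker_le_comap M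
  have h1 := LinearMap.finrank_range_add_finrank_ker (M.domRestrict (W.comap M))
  have h2 : LinearMap.range (M.domRestrict (W.comap M)) = W := by
    rw [LinearMap.range_domRestrict, Submodule.map_comap_eq, hrange, inf_eq_right.2 hWW]
  have h3 : Module.finrank (ZMod 2) (LinearMap.ker (M.domRestrict (W.comap M))) = r := by
    rw [LinearMap.ker_domRestrict, (Submodule.comapSubtypeEquivOfLe hle).finrank_eq, hkerr]
  rw [h2, hWr, h3] at h1
  rw [hrad, ← h1, two_mul]

end

/-! ### Words with a given radical -/

/-- The functions on `K` that are combinations of the monomials `x^u` with `u ∈ exponentSet m d`. -/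
def monomialSpan (K : Type*) [Field K] (m d : ℕ) : Submodule K (K → K) where
  carrier := {g | ∃ A : ℕ → K, ∀ x, g x = ∑ u ∈ exponentSet m d, A u * x ^ u}
  zero_mem' := ⟨0, fun x => by simp⟩
  add_mem' := by
    rintro g g' ⟨A, hA⟩ ⟨A', hA'⟩
    exact ⟨A + A', fun x => by simp [hA, hA', add_mul, Finset.sum_add_distrib]⟩
  smul_mem' := by
    rintro a g ⟨A, hA⟩
    exact ⟨a • A, fun x => by simp [hA, Finset.mul_sum, mul_assoc]⟩

section

variable {K : Type*} [Field K] {m d : ℕ}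

theorem monomial_mem_monomialSpan {u : ℕ} (hu : u ∈ exponentSet m d) :
    (fun x : K => x ^ u) ∈ monomialSpan K m d := by
  refine ⟨fun v => if v = u then 1 else 0, fun x => ?_⟩
  rw [Finset.sum_eq_single u]
  · simp
  · intro v _ hv
    simp [hv]
  · exact fun h => absurd hu h

theorem exponentSet_anti {d' : ℕ} (h : d ≤ d') : exponentSet m d' ⊆ exponentSet m d := by
  intro u hu
  rw [mem_exponentSet] at hu ⊢
  refine hu.imp_right (Or.imp_right ?_)
  rintro ⟨a, b, hb, h1, h2, rfl⟩
  exact ⟨a, b, hb, by omega, by omega, rfl⟩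

theorem monomialSpan_anti {d' : ℕ} (h : d ≤ d') : monomialSpan K m d' ≤ monomialSpan K m d := by
  rintro g ⟨A, hA⟩
  have : g = ∑ u ∈ exponentSet m d', A u • fun x : K => x ^ u := by
    funext x
    simp [hA]
  rw [this]
  exact Submodule.sum_mem _ fun u hu =>
    Submodule.smul_mem _ _ (monomial_mem_monomialSpan (exponentSet_anti h hu))

theorem pow_two_pow_mod (hpow : ∀ x : K, x ^ 2 ^ m = x) (x : K) (a : ℕ) :
    x ^ 2 ^ a = x ^ 2 ^ (a % m) := by
  have h : ∀ q : ℕ, x ^ 2 ^ (m * q) = x := by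
    intro q
    induction q with
    | zero => simp
    | succ q ih => rw [mul_add, mul_one, pow_add, pow_mul, ih, hpow]
  conv_lhs => rw [← Nat.div_add_mod a m, pow_add, pow_mul, h]

/-- On the field the exponents `2^a + 2^(a+s)` may be reduced modulo `2^m - 1`, so that only the
cyclic distance `s` of the two binary digits matters. -/
theorem monomial_mul_mem_monomialSpan (hpow : ∀ x : K, x ^ 2 ^ m = x) (hm : 0 < m) {a b : ℕ}
    (hab : a + d ≤ b) (hba : b + d ≤ a + m) :
    (fun x : K => x ^ 2 ^ a * x ^ 2 ^ b) ∈ monomialSpan K m d := by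
  have hlt : a % m < m := Nat.mod_lt _ hm
  have hb : ∀ x : K, x ^ 2 ^ b = x ^ 2 ^ (a % m + (b - a)) := by
    intro x
    obtain ⟨s, rfl⟩ : ∃ s, b = a + s := ⟨b - a, by omega⟩
    rw [Nat.add_sub_cancel_left, pow_add, pow_mul, pow_two_pow_mod hpow x a, ← pow_mul, ← pow_add]
  by_cases h : a % m + (b - a) < m
  · convert monomial_mem_monomialSpan (K := K) (m := m) (d := d)
      (u := 2 ^ (a % m) + 2 ^ (a % m + (b - a)))
      (mem_exponentSet.2 (Or.inr (Or.inr ⟨_, _, h, by omega, by omega, rfl⟩))) using 1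
    funext x
    rw [hb, pow_two_pow_mod hpow x a, ← pow_add]
  · convert monomial_mem_monomialSpan (K := K) (m := m) (d := d)
      (u := 2 ^ (a % m + (b - a) - m) + 2 ^ (a % m))
      (mem_exponentSet.2 (Or.inr (Or.inr ⟨_, _, hlt, by omega, by omega, rfl⟩))) using 1
    funext x
    have h2 : a % m + (b - a) = m + (a % m + (b - a) - m) := by omega
    rw [hb, pow_two_pow_mod hpow x a, h2, pow_add 2 m, pow_mul, hpow, Nat.add_sub_cancel_left,
      pow_add, mul_comm]

end

section

variable {K : Type*} [Field K] [Algebra (ZMod 2) K] [Fintype K]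

theorem linear_mem_monomialSpan {m d : ℕ} (hm : Module.finrank (ZMod 2) K = m)
    (l : K →ₗ[ZMod 2] ZMod 2) :
    (fun x => algebraMap (ZMod 2) K (l x)) ∈ monomialSpan K m d := by
  obtain ⟨a, ha⟩ := (LinearMap.BilinForm.toDual (Algebra.traceForm (ZMod 2) K)
    (traceForm_nondegenerate (ZMod 2) K)).surjective l
  have h1 : (fun x => algebraMap (ZMod 2) K (l x)) =
      ∑ i ∈ Finset.range m, (a ^ 2 ^ i) • fun x : K => x ^ 2 ^ i := by
    funext x
    rw [← ha]
    change algebraMap (ZMod 2) K (Algebra.trace (ZMod 2) K (a * x)) = _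
    rw [algebraMap_trace_eq_sum, hm]
    simp [mul_pow]
  rw [h1]
  exact Submodule.sum_mem _ fun i hi => Submodule.smul_mem _ _ (monomial_mem_monomialSpan
    (mem_exponentSet.2 (Or.inr (Or.inl ⟨i, Finset.mem_range.1 hi, rfl⟩))))

variable [CharP K 2]

/-- The quadratic function `x ↦ ∑_{i < k} (M(x) M(x)^(2^k))^(2^i)`, the trace from the subfield of
index two of the norm of `M(x)`, takes its values in the prime field, and its polar form is
`⟨M x, M y⟩`. -/
theorem exists_quadratic {k r : ℕ} (hk : Module.finrank (ZMod 2) K = 2 * k) (hk0 : 0 < k)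
    (hr : r ≤ k) (μ : Fin (r + 1) → K) :
    ∃ Q : K → ZMod 2, (fun x => algebraMap (ZMod 2) K (Q x)) ∈ monomialSpan K (2 * k) (k - r) ∧
      Q 0 = 0 ∧ ∀ x y, Q (x + y) = Q x + Q y + Q 0 +
        (twistedTraceForm K k).compl₁₂ (linearizedMap μ) (linearizedMap μ) x y := by
  set M := linearizedMap μ with hM
  let q : K → K := fun x => ∑ i ∈ Finset.range k, (M x * M x ^ 2 ^ k) ^ 2 ^ i
  have hq : ∀ x, q x = 0 ∨ q x = 1 := by
    intro x
    set z := M x * M x ^ 2 ^ k with hz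
    have hzk : z ^ 2 ^ k = z := by rw [hz, mul_pow, involution_involution hk, mul_comm]
    have h1 : q x ^ 2 = q x := by
      have e1 : q x ^ 2 = ∑ i ∈ Finset.range k, z ^ 2 ^ (i + 1) := by
        simp only [q, ← hz]
        rw [sum_pow_char 2]
        refine Finset.sum_congr rfl fun i _ => ?_
        rw [← pow_mul, ← pow_succ]
      have e2 := Finset.sum_range_succ' (fun i => z ^ 2 ^ i) k
      rw [Finset.sum_range_succ, hzk, pow_zero, pow_one] at e2
      rw [e1, ← add_right_cancel e2]
    have h2 : q x * (q x - 1) = 0 := by linear_combination h1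
    rcases mul_eq_zero.1 h2 with h | h
    · exact Or.inl h
    · exact Or.inr (sub_eq_zero.1 h)
  have hQ : ∀ x, ∃ a : ZMod 2, algebraMap (ZMod 2) K a = q x := by
    intro x
    rcases hq x with h | h
    · exact ⟨0, by rw [h, map_zero]⟩
    · exact ⟨1, by rw [h, map_one]⟩
  choose Q hQ using hQ
  have hinj := (algebraMap (ZMod 2) K).injective
  have hQ0 : Q 0 = 0 := by
    apply hinj
    rw [hQ, map_zero]
    refine Finset.sum_eq_zero fun i _ => ?_
    rw [map_zero, zero_mul, zero_pow (by positivity)]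
  refine ⟨Q, ?_, hQ0, fun x y => ?_⟩
  · have h1 : (fun x => algebraMap (ZMod 2) K (Q x)) =
        ∑ i ∈ Finset.range k, ∑ j : Fin (r + 1), ∑ l : Fin (r + 1),
          (μ j ^ 2 ^ (j + i : ℕ) * μ l ^ 2 ^ (l + k + i : ℕ)) •
            fun x : K => x ^ 2 ^ (j + i : ℕ) * x ^ 2 ^ (l + k + i : ℕ) := by
      funext x
      simp only [hQ, q, hM, linearizedMap_apply, sum_pow_char_pow, Finset.sum_mul_sum,
        Finset.sum_apply, Pi.smul_apply, smul_eq_mul]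
      refine Finset.sum_congr rfl fun i _ => Finset.sum_congr rfl fun j _ =>
        Finset.sum_congr rfl fun l _ => ?_
      simp only [mul_pow, ← pow_mul, ← pow_add]
      ring
    rw [h1]
    refine Submodule.sum_mem _ fun i _ => Submodule.sum_mem _ fun j _ =>
      Submodule.sum_mem _ fun l _ => Submodule.smul_mem _ _ ?_
    exact monomial_mul_mem_monomialSpan (hk ▸ pow_two_pow_finrank) (by omega) (by omega) (by omega)
  · apply hinj
    simp only [map_add, hQ, hQ0, add_zero]
    change _ = _ + algebraMap (ZMod 2) K (Algebra.trace (ZMod 2) K (M x * M y ^ 2 ^ k))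
    rw [algebraMap_trace_eq_sum, hk, two_mul, Finset.sum_range_add, ← Finset.sum_add_distrib]
    simp only [q, ← Finset.sum_add_distrib]
    refine Finset.sum_congr rfl fun i _ => ?_
    have h1 : (M x + M y) ^ 2 ^ k = M x ^ 2 ^ k + M y ^ 2 ^ k := add_pow_char_pow ..
    have h2 : ∀ a b : K, (a + b) ^ 2 ^ i = a ^ 2 ^ i + b ^ 2 ^ i := fun a b =>
      add_pow_char_pow ..
    rw [pow_add 2 k i, pow_mul, mul_pow (M x) _ (2 ^ k), involution_involution hk, map_add, h1,
      ← h2, ← h2, ← h2]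
    congr 1
    ring

/-- Subtracting a linear extension of the restriction of the quadratic function to its radical
gives a word whose character sum does not vanish. -/
theorem exists_signSum_eq {k h : ℕ} (hk : Module.finrank (ZMod 2) K = 2 * k) (hh : 1 ≤ h)
    (hhk : h ≤ k) :
    ∃ f : K → ZMod 2, (fun x => algebraMap (ZMod 2) K (f x)) ∈ monomialSpan K (2 * k) h ∧
      (signSum f = 2 ^ (2 * k - h) ∨ signSum f = -2 ^ (2 * k - h)) := by
  obtain ⟨μ, hμ⟩ := exists_linearizedMap_radical hk (Nat.sub_le k h)
  obtain ⟨Q, hQmem, hQ0, hQ⟩ := exists_quadratic hk (by omega) (Nat.sub_le k h) μ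
  rw [Nat.sub_sub_self hhk] at hQmem
  set B := (twistedTraceForm K k).compl₁₂ (linearizedMap μ) (linearizedMap μ) with hB
  let L : LinearMap.ker B →ₗ[ZMod 2] ZMod 2 := AddMonoidHom.toZModLinearMap 2
    { toFun := fun v => Q v
      map_zero' := hQ0
      map_add' := fun v w => by
        have h1 : B v w = 0 := by
          rw [LinearMap.mem_ker.1 v.2]
          rfl
        rw [Submodule.coe_add, hQ, h1, hQ0, add_zero, add_zero] }
  obtain ⟨l, hl⟩ := L.exists_extend
  refine ⟨fun x => Q x + l x, ?_, ?_⟩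
  · simp only [map_add]
    exact (monomialSpan K (2 * k) h).add_mem hQmem (linear_mem_monomialSpan hk l)
  · have hpolar : ∀ x y, Q (x + y) + l (x + y) = Q x + l x + (Q y + l y) + (Q 0 + l 0) + B x y := by
      intro x y
      rw [hQ, map_add, map_zero]
      ring
    obtain ⟨h', h1, h2⟩ := signSum_eq_or (f := fun x => Q x + l x) hpolar (fun u hu => by
      have h3 : l u = Q u := LinearMap.congr_fun hl ⟨u, hu⟩
      rw [h3, CharTwo.add_self_eq_zero, hQ0, map_zero, add_zero])
    rw [hμ, hk] at h1
    have h4 : h' = h := by omega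
    rwa [hk, h4] at h2

end

/-! ### The weights -/

section

variable {K : Type*} [Field K] [Algebra (ZMod 2) K] [Fintype K] [CharP K 2] {t d : ℕ}
  {φ : K ≃ₗ[ZMod 2] (Fin (2 * t + 2) → ZMod 2)}
  {C : Submodule (ZMod 2) ((Fin (2 * t + 2) → ZMod 2) → ZMod 2)}

omit [Fintype K] [CharP K 2] in
theorem one_mem_of_mem_iff
    (hC : ∀ F, F ∈ C ↔
      (fun x => algebraMap (ZMod 2) K (F (φ x))) ∈ monomialSpan K (2 * t + 2) d) :
    (1 : (Fin (2 * t + 2) → ZMod 2) → ZMod 2) ∈ C := by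
  rw [hC]
  convert monomial_mem_monomialSpan (K := K) (m := 2 * t + 2) (d := d)
    (mem_exponentSet.2 (Or.inl rfl)) using 1
  funext x
  simp

/-- Either the word is not constant on the radical of its polar form and it is balanced, or the
radical determines its weight up to complementation. A vanishing polar form in the second case would
make the word constant. -/
theorem hammingNorm_mem (hdt : d ≤ t + 1) (hK : Module.finrank (ZMod 2) K = 2 * t + 2)
    (hC : ∀ F, F ∈ C ↔
      (fun x => algebraMap (ZMod 2) K (F (φ x))) ∈ monomialSpan K (2 * t + 2) d)
    {F : (Fin (2 * t + 2) → ZMod 2) → ZMod 2} (hF : F ∈ C) (h0 : F ≠ 0) (h1 : F ≠ 1) :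
    hammingNorm F = 2 ^ (2 * t + 2 - 1) ∨ ∃ h : ℕ, d ≤ h ∧ h ≤ t + 1 ∧
      (hammingNorm F = 2 ^ (2 * t + 2 - 1) - 2 ^ (2 * t + 2 - h - 1) ∨
        hammingNorm F = 2 ^ (2 * t + 2 - 1) + 2 ^ (2 * t + 2 - h - 1)) := by
  have hcard : Fintype.card K = 2 ^ (2 * t + 2) := by
    rw [Module.card_eq_pow_finrank (K := ZMod 2), ZMod.card, hK]
  obtain ⟨A, hA⟩ := (hC F).1 hF
  obtain ⟨B, hB, hrank⟩ := exists_polar (by omega) hcard hA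
  have hS := signSum_comp_eq φ F
  have e1 : (2 : ℤ) ^ (2 * t + 2) = 2 * 2 ^ (2 * t + 2 - 1) := by
    rw [← pow_succ']
    congr 1
  by_cases hrad : ∀ u ∈ LinearMap.ker B, F (φ u) = F (φ 0)
  · obtain ⟨h, hh, hsum⟩ := signSum_eq_or hB hrad
    rw [hK] at hh hsum
    have hB0 : B ≠ 0 := by
      intro hB0
      have hconst : ∀ v, F v = F (φ 0) := by
        intro v
        rw [← hrad (φ.symm v) (by rw [hB0]; rfl), φ.apply_symm_apply]
      by_cases h2 : F (φ 0) = 0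
      · exact h0 (funext fun v => (hconst v).trans h2)
      · exact h1 (funext fun v => (hconst v).trans (ZMod.eq_one_of_ne_zero_two h2))
    have hle := hrank hB0
    have hpos : h ≠ 0 := by
      rintro rfl
      apply hB0
      rw [← LinearMap.ker_eq_top]
      exact Submodule.eq_top_of_finrank_eq (by omega)
    have hdh : d ≤ h := by omega
    refine Or.inr ⟨h, hdh, by omega, ?_⟩
    have e2 : (2 : ℤ) ^ (2 * t + 2 - h) = 2 * 2 ^ (2 * t + 2 - h - 1) := by
      rw [← pow_succ']
      congr 1
      omega
    have e3 : 2 ^ (2 * t + 2 - h - 1) ≤ 2 ^ (2 * t + 2 - 1) :=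
      Nat.pow_le_pow_right (by norm_num) (by omega)
    zify [e3]
    rw [hS] at hsum
    rcases hsum with h2 | h2
    · left
      linarith
    · right
      linarith
  · push Not at hrad
    obtain ⟨u, hu, hne⟩ := hrad
    have h2 := signSum_eq_zero (f := fun x => F (φ x)) hB hu hne
    rw [hS] at h2
    left
    zify
    linarith

omit [Fintype K] [CharP K 2] in
theorem ne_zero_and_ne_one_of_hammingNorm {m w : ℕ} {F : (Fin m → ZMod 2) → ZMod 2}
    (hF : hammingNorm F = w) (hw : 0 < w) (hw' : w < 2 ^ m) : F ≠ 0 ∧ F ≠ 1 := by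
  constructor
  · rintro rfl
    rw [hammingNorm_zero] at hF
    omega
  · rintro rfl
    simp [hammingNorm] at hF
    omega

omit [CharP K 2] in
theorem exists_hammingNorm_eq_half (hK : Module.finrank (ZMod 2) K = 2 * t + 2)
    (hC : ∀ F, F ∈ C ↔
      (fun x => algebraMap (ZMod 2) K (F (φ x))) ∈ monomialSpan K (2 * t + 2) d) :
    ∃ F ∈ C, hammingNorm F = 2 ^ (2 * t + 2 - 1) := by
  let l : K →ₗ[ZMod 2] ZMod 2 := LinearMap.proj 0 ∘ₗ φ.toLinearMap
  have hl : l ≠ 0 := by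
    intro h
    have h1 : l (φ.symm (Pi.single 0 1)) = 0 := by rw [h, LinearMap.zero_apply]
    simp [l] at h1
  refine ⟨fun v => v 0, (hC _).2 (linear_mem_monomialSpan hK l), ?_⟩
  have h1 := signSum_comp_eq φ fun v => v 0
  have h2 : signSum (fun x => φ x 0) = 0 := sum_signChar_linear_of_ne_zero hl
  rw [h2] at h1
  have e1 : (2 : ℤ) ^ (2 * t + 2) = 2 * 2 ^ (2 * t + 2 - 1) := by
    rw [← pow_succ']
    congr 1
  zify
  linarith

theorem exists_hammingNorm_eq (hd : 1 ≤ d) (hK : Module.finrank (ZMod 2) K = 2 * t + 2)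
    (hC : ∀ F, F ∈ C ↔
      (fun x => algebraMap (ZMod 2) K (F (φ x))) ∈ monomialSpan K (2 * t + 2) d)
    {h : ℕ} (hdh : d ≤ h) (hht : h ≤ t + 1) :
    (∃ F ∈ C, hammingNorm F = 2 ^ (2 * t + 2 - 1) - 2 ^ (2 * t + 2 - h - 1)) ∧
      ∃ F ∈ C, hammingNorm F = 2 ^ (2 * t + 2 - 1) + 2 ^ (2 * t + 2 - h - 1) := by
  have e0 : 2 * (t + 1) = 2 * t + 2 := by ring
  obtain ⟨f, hf, hS⟩ := exists_signSum_eq (K := K) (k := t + 1) (h := h) (by omega) (by omega) hht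
  rw [e0] at hf hS
  set F : (Fin (2 * t + 2) → ZMod 2) → ZMod 2 := fun v => f (φ.symm v)
  have hFφ : ∀ x, F (φ x) = f x := fun x => congrArg f (φ.symm_apply_apply x)
  have hF : F ∈ C := by
    rw [hC]
    simp only [hFφ]
    exact monomialSpan_anti hdh hf
  have hF1 : F + 1 ∈ C := C.add_mem hF (one_mem_of_mem_iff hC)
  have hS0 := signSum_comp_eq φ F
  have hS1 := signSum_comp_eq φ (F + 1)
  simp only [Pi.add_apply, Pi.one_apply, signSum_add_one, hFφ] at hS0 hS1
  have e1 : (2 : ℤ) ^ (2 * t + 2) = 2 * 2 ^ (2 * t + 2 - 1) := by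
    rw [← pow_succ']
    congr 1
  have e2 : (2 : ℤ) ^ (2 * t + 2 - h) = 2 * 2 ^ (2 * t + 2 - h - 1) := by
    rw [← pow_succ']
    congr 1
    omega
  have e3 : 2 ^ (2 * t + 2 - h - 1) ≤ 2 ^ (2 * t + 2 - 1) :=
    Nat.pow_le_pow_right (by norm_num) (by omega)
  rcases hS with h2 | h2
  · refine ⟨⟨F, hF, ?_⟩, ⟨F + 1, hF1, ?_⟩⟩ <;> zify [e3] <;> linarith
  · refine ⟨⟨F + 1, hF1, ?_⟩, ⟨F, hF, ?_⟩⟩ <;> zify [e3] <;> linarith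

theorem weights_eq (hd : 1 ≤ d) (hdt : d ≤ t + 1)
    (hK : Module.finrank (ZMod 2) K = 2 * t + 2)
    (hC : ∀ F, F ∈ C ↔
      (fun x => algebraMap (ZMod 2) K (F (φ x))) ∈ monomialSpan K (2 * t + 2) d) :
    {w : ℕ | ∃ c ∈ C, c ≠ 0 ∧ c ≠ 1 ∧ hammingNorm c = w} =
      {w : ℕ | w = 2 ^ (2 * t + 2 - 1) ∨ ∃ h : ℕ, d ≤ h ∧ h ≤ t + 1 ∧
        (w = 2 ^ (2 * t + 2 - 1) - 2 ^ (2 * t + 2 - h - 1) ∨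
          w = 2 ^ (2 * t + 2 - 1) + 2 ^ (2 * t + 2 - h - 1))} := by
  ext w
  have e1 : 2 ^ (2 * t + 2) = 2 * 2 ^ (2 * t + 2 - 1) := by
    rw [← pow_succ']
    congr 1
  have hpos : 0 < 2 ^ (2 * t + 2 - 1) := by positivity
  constructor
  · rintro ⟨F, hF, h0, h1, rfl⟩
    exact hammingNorm_mem hdt hK hC hF h0 h1
  · rintro (rfl | ⟨h, hdh, hht, hw⟩)
    · obtain ⟨F, hF, hw⟩ := exists_hammingNorm_eq_half hK hC
      obtain ⟨h0, h1⟩ := ne_zero_and_ne_one_of_hammingNorm hw hpos (by omega)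
      exact ⟨F, hF, h0, h1, hw⟩
    · have hlt : 2 ^ (2 * t + 2 - h - 1) < 2 ^ (2 * t + 2 - 1) :=
        Nat.pow_lt_pow_right (by norm_num) (by omega)
      have hpos' : 0 < 2 ^ (2 * t + 2 - h - 1) := by positivity
      obtain ⟨⟨F, hF, hFw⟩, ⟨G, hG, hGw⟩⟩ := exists_hammingNorm_eq hd hK hC hdh hht
      rcases hw with rfl | rfl
      · obtain ⟨h0, h1⟩ := ne_zero_and_ne_one_of_hammingNorm hFw (by omega) (by omega)
        exact ⟨F, hF, h0, h1, hFw⟩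
      · obtain ⟨h0, h1⟩ := ne_zero_and_ne_one_of_hammingNorm hGw (by omega) (by omega)
        exact ⟨G, hG, h0, h1, hGw⟩

theorem isLeast_hammingDist (hd : 1 ≤ d) (hdt : d ≤ t + 1)
    (hK : Module.finrank (ZMod 2) K = 2 * t + 2)
    (hC : ∀ F, F ∈ C ↔
      (fun x => algebraMap (ZMod 2) K (F (φ x))) ∈ monomialSpan K (2 * t + 2) d) :
    IsLeast {w : ℕ | ∃ x ∈ C, ∃ y ∈ C, x ≠ y ∧ hammingDist x y = w}
      (2 ^ (2 * t + 2 - 1) - 2 ^ (2 * t + 2 - d - 1)) := by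
  constructor
  · obtain ⟨F, hF, h0, -, hw⟩ : (2 ^ (2 * t + 2 - 1) - 2 ^ (2 * t + 2 - d - 1)) ∈
        {w : ℕ | ∃ c ∈ C, c ≠ 0 ∧ c ≠ 1 ∧ hammingNorm c = w} := by
      rw [weights_eq hd hdt hK hC]
      exact Or.inr ⟨d, le_rfl, hdt, Or.inl rfl⟩
    exact ⟨F, hF, 0, C.zero_mem, h0, by rw [hammingDist_zero_right, hw]⟩
  · rintro w ⟨x, hx, y, hy, hne, rfl⟩
    rw [hammingDist_eq_hammingNorm, neg_add_eq_sub]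
    by_cases h1 : y - x = 1
    · have h2 : hammingNorm (1 : (Fin (2 * t + 2) → ZMod 2) → ZMod 2) = 2 ^ (2 * t + 2) := by
        simp [hammingNorm]
      rw [h1, h2]
      exact (Nat.sub_le _ _).trans (Nat.pow_le_pow_right (by norm_num) (Nat.sub_le _ _))
    · rcases hammingNorm_mem hdt hK hC (C.sub_mem hy hx) (sub_ne_zero.2 hne.symm) h1 with
        h | ⟨h, hdh, -, h | h⟩
      · rw [h]
        exact Nat.sub_le _ _
      · rw [h]
        exact Nat.sub_le_sub_left (Nat.pow_le_pow_right (by norm_num) (by omega)) _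
      · rw [h]
        exact (Nat.sub_le _ _).trans (Nat.le_add_right _ _)

end

section

variable {K : Type*} [Field K] [Algebra (ZMod 2) K] {n m : ℕ} {α : K}

theorem finrank_extendedCyclicCode (φ : K ≃ₗ[ZMod 2] (Fin m → ZMod 2))
    (hα : IsPrimitiveRoot α (2 ^ m - 1)) (I : Ideal (CyclicRing (2 ^ m - 1))) :
    Module.finrank (ZMod 2) (extendedCyclicCode φ α I) =
      Module.finrank (ZMod 2) (cyclicCode I) := by
  have hext : Function.Injective (parityExtend (2 ^ m - 1)) := fun c c' h =>
    funext fun i => congrFun h (some i)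
  let e : ((Fin m → ZMod 2) → ZMod 2) ≃ₗ[ZMod 2] (Option (Fin (2 ^ m - 1)) → ZMod 2) :=
    LinearEquiv.funCongrLeft (ZMod 2) (ZMod 2) (Equiv.ofBijective _ (position_bijective φ hα))
  have h1 : (extendedCyclicCode φ α I).map (e : _ →ₗ[ZMod 2] _) = extendedCode (cyclicCode I) :=
    Submodule.map_comap_eq_of_surjective e.surjective _
  rw [← LinearEquiv.finrank_map_eq e, h1, extendedCode]
  exact (Submodule.equivMapOfInjective _ hext _).finrank_eq.symm

theorem cyclicCode_le_puncturedReedMuller {r : ℕ} {φ : K ≃ₗ[ZMod 2] (Fin m → ZMod 2)}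
    (hα : IsPrimitiveRoot α (2 ^ m - 1)) {I : Ideal (CyclicRing (2 ^ m - 1))}
    (h : extendedCyclicCode φ α I ≤ reedMuller r m) :
    cyclicCode I ≤ puncturedReedMuller r φ α := by
  intro c hc
  let p := Equiv.ofBijective _ (position_bijective φ hα)
  let F : (Fin m → ZMod 2) → ZMod 2 := fun v => parityExtend _ c (p.symm v)
  have hF : ∀ i, F (position φ α i) = parityExtend _ c i := fun i =>
    congrArg (parityExtend _ c) (p.symm_apply_apply i)
  refine Submodule.mem_map.2 ⟨F, h ?_, ?_⟩
  · refine Submodule.mem_comap.2 (Submodule.mem_map.2 ⟨c, hc, ?_⟩)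
    funext i
    exact (hF i).symm
  · funext i
    exact hF (some i)

open Classical in
/-- The number of nonzeros is the number of exponents: `u ↦ (n - u) % n` is a bijection. -/
theorem card_filter_dvd_add (hn : 0 < n) {E : Finset ℕ} (hE : ∀ u ∈ E, u < n) :
    ((Finset.range n).filter fun j => ∃ u ∈ E, n ∣ j + u).card = E.card := by
  symm
  refine Finset.card_bij (fun u _ => (n - u) % n) ?_ ?_ ?_
  · intro u hu
    refine Finset.mem_filter.2 ⟨Finset.mem_range.2 (Nat.mod_lt _ hn), u, hu, ?_⟩
    rw [Nat.dvd_iff_mod_eq_zero, Nat.mod_add_mod, Nat.sub_add_cancel (hE u hu).le, Nat.mod_self]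
  · intro u hu v hv h
    refine eq_of_dvd_sub_add (hE u hu) (hE v hv) ?_
    rw [Nat.dvd_iff_mod_eq_zero, ← Nat.mod_add_mod, h, Nat.mod_add_mod,
      Nat.sub_add_cancel (hE v hv).le, Nat.mod_self]
  · intro j hj
    obtain ⟨hj, u, hu, hdvd⟩ := Finset.mem_filter.1 hj
    refine ⟨u, hu, ?_⟩
    have hj' := Finset.mem_range.1 hj
    have hu' := hE u hu
    obtain ⟨c, hc⟩ := hdvd
    have hc2 : c < 2 := by
      by_contra h
      have := Nat.mul_le_mul_left n (not_lt.1 h)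
      omega
    interval_cases c
    · have hu0 : u = 0 := by omega
      have hj0 : j = 0 := by omega
      rw [hu0, hj0, Nat.sub_zero, Nat.mod_self]
    · have hj2 : n - u = j := by omega
      rw [hj2, Nat.mod_eq_of_lt hj']

end

/-! ### The parameters and weights of the subcode -/

theorem mainTheorem2 (t d : ℕ) (ht : 1 ≤ t) (hd : 1 ≤ d) (hdt : d ≤ t + 1)
    (α : GaloisField 2 (2 * t + 2)) (hα : IsPrimitiveRoot α (2 ^ (2 * t + 2) - 1))
    (φ : GaloisField 2 (2 * t + 2) ≃ₗ[ZMod 2] (Fin (2 * t + 2) → ZMod 2)) :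
    ∃ I : Ideal (CyclicRing (2 ^ (2 * t + 2) - 1)),
      IsIdempotentOf (subcodeIdempotent t d α) I ∧
      cyclicCode I ≤ puncturedReedMuller 2 φ α ∧
      extendedCyclicCode φ α I ≤ reedMuller 2 (2 * t + 2) ∧
      IsLinearCode (extendedCyclicCode φ α I)
        (2 ^ (2 * t + 2))
        ((2 * t + 2) * (t + 2 - d) + (2 * t + 2) / 2 + 1)
        (2 ^ (2 * t + 2 - 1) - 2 ^ (2 * t + 2 - d - 1)) ∧
      (1 : (Fin (2 * t + 2) → ZMod 2) → ZMod 2) ∈ extendedCyclicCode φ α I ∧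
      {w : ℕ | ∃ c ∈ extendedCyclicCode φ α I, c ≠ 0 ∧ c ≠ 1 ∧ hammingNorm c = w} =
        {w : ℕ | w = 2 ^ (2 * t + 2 - 1) ∨
          ∃ h : ℕ, d ≤ h ∧ h ≤ t + 1 ∧
            (w = 2 ^ (2 * t + 2 - 1) - 2 ^ (2 * t + 2 - h - 1) ∨
              w = 2 ^ (2 * t + 2 - 1) + 2 ^ (2 * t + 2 - h - 1))} := by
  classical
  let _ : Fintype (GaloisField 2 (2 * t + 2)) := Fintype.ofFinite _
  have hK : Module.finrank (ZMod 2) (GaloisField 2 (2 * t + 2)) = 2 * t + 2 :=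
    GaloisField.finrank 2 (by omega)
  have hcard : Fintype.card (GaloisField 2 (2 * t + 2)) = 2 ^ (2 * t + 2) := by
    rw [Module.card_eq_pow_finrank (K := ZMod 2), ZMod.card, hK]
  have hE : ∀ u ∈ exponentSet (2 * t + 2) d, u < 2 ^ (2 * t + 2) - 1 := fun u hu =>
    lt_of_mem_exponentSet (by omega) hd hu
  have h0 : 0 ∈ exponentSet (2 * t + 2) d := mem_exponentSet.2 (Or.inl rfl)
  have hn : 0 < 2 ^ (2 * t + 2) - 1 := hE 0 h0
  have he := aeval_subcodePolynomial ht hd hdt hα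
  set I : Ideal (CyclicRing (2 ^ (2 * t + 2) - 1)) :=
    Ideal.span {Ideal.Quotient.mk _ (subcodePolynomial t d α)} with hI
  have hmem : ∀ F, F ∈ extendedCyclicCode φ α I ↔
      (fun x => algebraMap (ZMod 2) (GaloisField 2 (2 * t + 2)) (F (φ x))) ∈
        monomialSpan (GaloisField 2 (2 * t + 2)) (2 * t + 2) d := fun F =>
    mem_extendedCyclicCode_span_iff hα
      (fun x hx => hcard ▸ FiniteField.pow_card_sub_one_eq_one x hx) φ hE h0 he
  have hRM : extendedCyclicCode φ α I ≤ reedMuller 2 (2 * t + 2) := by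
    intro F hF
    obtain ⟨A, hA⟩ := (hmem F).1 hF
    exact mem_reedMuller_of_eq_sum φ hA
  refine ⟨I, ⟨?_, ?_⟩, cyclicCode_le_puncturedReedMuller hα hRM, hRM, ⟨?_, ?_, ?_⟩,
    one_mem_of_mem_iff hmem, weights_eq hd hdt hK hmem⟩
  · rw [← mk_subcodePolynomial]
    exact isIdempotentElem_mk_of_aeval hn hα he
  · rw [← mk_subcodePolynomial]
  · simp
  · rw [finrank_extendedCyclicCode φ hα, hI, finrank_cyclicCode_span hn hα he,
      card_filter_dvd_add hn hE, card_exponentSet hd hdt]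
  · exact isLeast_hammingDist hd hdt hK hmem
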